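/- Let $k=\mathbb F_q$ be a finite field, $E$ an elliptic curve over $k$ with $q$-th power Frobenius endomorphism $F$, $\bar k$ an algebraic closure of $k$, and $N\ge 1$ a square-free integer; let $k_N=\mathbb F_{q^N}\subset\bar k$. Let $P(N)$ be the set of primes dividing $N$. For $r\in P(N)$ let $G_r\subset E(\bar k)$ be the kernel of $1+F+\dots+F^{r-1}$ (a finite subgroup of $E(\mathbb F_{q^r})$), and define the divisors $$D_r=\sum_{x\in G_r}(x)\quad (r\in P(N)),\qquad D_N=\sum_{x\in X_N}(x),\quad X_N=\bigcup_{r\in P(N)}G_r .$$ For a field $K$ with $k_N\subset K\subset \bar k$ and an effective divisor $D$ defined over $K$ put $\mathcal L(D)=\{f\in K(E)\mid \operatorname{div}(f)+D\ge 0\}$ (with $0\in\mathcal L(D)$); for a finite set $\Sigma\subset E(K)$ disjoint from the support of $D$ and a point $P\in\Sigma$ put $\Sigma^*=\Sigma\setminus\{P\}$ and $\mathcal L_0(D)=\{f\in\mathcal L(D)\mid f(P)=0\}$, and let $\mathcal C^0_L(D,\Sigma^*)$ be the evaluation map $\mathcal L_0(D)\to K^{\Sigma^*}$, $f\mapsto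 (f(s))_{s\in\Sigma^*}$. An injective $K$-linear map $e:C\to K^n$ is called an MDS code if its minimal distance (the least Hamming weight of a non-zero element of $e(C)$) equals $n-\dim_K C+1$; the zero code, $C=0$, is regarded as MDS. Then for every integer $m>\deg(D_N)$ there are a finite extension $K$ of $k_N$ in $\bar k$ and a set $\Sigma\subset E(K)$ such that 1. $\Sigma$ is disjoint from the support of $D_N$ and $|\Sigma|=m$; 2. for every choice of $P\in\Sigma$, the maps $\mathcal C^0_L(D_N,\Sigma^*)$ and $\mathcal C^0_L(D_r,\Sigma^*)$, $r\in P(N)$, over $K$ are all (injective and) MDS codes. In particular the decomposition $$\mathcal L_0(D_N)=\bigoplus_{r\in P(N)}\mathcal L_0(D_r)$$ (which holds over $K$) is proper, that is, the evaluation map restricted to each factor is again MDS. -/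

import Mathlib

open Polynomial Module

namespace EllipticCode

/-! ### Codes -/

/-- The minimal distance of a code `e : V → K^ι`: the least Hamming weight of a non-zero codeword
(the value is `0` when there is no non-zero codeword). -/
noncomputable def minDist {K V ι : Type*} [Field K] [Fintype ι] (e : V → ι → K) : ℕ :=
  open scoped Classical in sInf {w : ℕ | ∃ x : V, e x ≠ 0 ∧ hammingNorm (e x) = w}

/-- `e : V → K^ι` is an MDS code: it is a linear embedding, and its minimal distance `d` attains the
Singleton bound, `d = |ι| - dim V + 1`. The zero code has no non-zero codeword, hence no minimal
distance; by the usual convention it is MDS. -/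
structure IsMDS {ι : Type*} [Fintype ι] (K : Type*) [Field K] {V : Type*} [AddCommGroup V]
    [Module K V] (e : V → ι → K) : Prop where
  linear : IsLinearMap K e
  injective : Function.Injective e
  minDist_add : Nontrivial V → minDist e + finrank K V = Fintype.card ι + 1

/-- The submodule `V` is the internal direct sum of the submodules `C j`. -/
def IsDirectSum {K F J : Type*} [Field K] [AddCommGroup F] [Module K F] (V : Submodule K F)
    (C : J → Submodule K F) : Prop :=
  iSupIndep C ∧ ⨆ j, C j = V

/-- Let `e` be defined on `F` and let its restriction to `V` be an MDS code. A decomposition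
`V = ⨁ C j` is proper if the restriction of `e` to every `C j` is an MDS code as well. -/
structure IsProperDecomposition {K F J ι : Type*} [Field K] [AddCommGroup F] [Module K F]
    [Fintype ι] (e : F → ι → K) (V : Submodule K F) (C : J → Submodule K F) : Prop where
  directSum : IsDirectSum V C
  mds : IsMDS K (fun f : V => e f)
  mds_factor : ∀ j, IsMDS K (fun f : C j => e f)

/-! ### Places of a function field -/

/-- The places of a field `F` over a field `K` of constants: the valuation rings of `F` that contain
`K` and are different from `F`. When `F` is the function field of a smooth projective curve over `K`
they are the local rings of its closed points, and they are discrete valuation rings. -/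
structure Place (K F : Type*) [Field K] [Field F] [Algebra K F] where
  /-- the valuation ring -/
  ring : ValuationSubring F
  const_mem : ∀ c : K, algebraMap K F c ∈ ring
  ne_top : ring ≠ ⊤

/-- `v.OrdGE f n` says that `ord_v f ≥ n` (with `ord_v 0 = ∞`): measured by the multiplicative
valuation of `v`, the element `f` is at most as large as the `n`-th power of a uniformizer. -/
def Place.OrdGE {K F : Type*} [Field K] [Field F] [Algebra K F] (v : Place K F) (f : F) (n : ℤ) :
    Prop :=
  ∀ π : v.ring, IsLocalRing.maximalIdeal v.ring = Ideal.span {π} →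
    v.ring.valuation f ≤ v.ring.valuation (π : F) ^ n

section Curve

variable {k Ω : Type*} [Field k] [Field Ω] [Algebra k Ω]

/-- The points of `E` with coordinates in the extension `Ω` of `k`. -/
abbrev Pt (E : WeierstrassCurve k) (Ω : Type*) [Field Ω] [Algebra k Ω] : Type _ :=
  (E.toAffine.baseChange Ω).Point

/-- The function field `K(E)` of `E` over the extension `K` of `k`. -/
abbrev FunField (E : WeierstrassCurve k) (K : Type*) [Field K] [Algebra k K] : Type _ :=
  (E.toAffine.baseChange K).FunctionField

/-- The rational function on `E` over `K` given by a polynomial in the coordinate functions. -/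
noncomputable def polyFun (E : WeierstrassCurve k) (K : Type*) [Field K] [Algebra k K]
    (p : K[X][X]) : FunField E K :=
  algebraMap (E.toAffine.baseChange K).CoordinateRing (FunField E K)
    (WeierstrassCurve.Affine.CoordinateRing.mk (E.toAffine.baseChange K) p)

/-- The point `Q ∈ E(Ω)` is `K`-rational, that is, in the image of `E(K) → E(Ω)`. -/
def IsRational (E : WeierstrassCurve k) (K : IntermediateField k Ω) (Q : Pt E Ω) : Prop :=
  open scoped Classical in
  ∃ R : Pt E K, WeierstrassCurve.Affine.Point.map (W' := E.toAffine) K.val R = Q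

/-- The place `v` of `K(E)` is (the local ring of) the closed point below the point `Q ∈ E(Ω)`.
For the point at infinity this says that the coordinate function `X` has a pole at `v`.
For an affine point it says that every regular function on the affine curve is regular at `v`, and
vanishes at `v` if and only if it vanishes at `Q`. -/
def LiesBelow {E : WeierstrassCurve k} {K : IntermediateField k Ω} (v : Place K (FunField E K)) :
    Pt E Ω → Prop
  | .zero => polyFun E K (C X) ∉ v.ring
  | .some x y _ => ∀ p : K[X][X], polyFun E K p ∈ v.ring ∧
      (v.ring.valuation (polyFun E K p) < 1 ↔
        (p.map (mapRingHom (algebraMap K Ω))).evalEval x y = 0)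

/-- The rational function `f` on `E` over `K` is regular at the point `Q`, with value `c ∈ K`. -/
def HasValue {E : WeierstrassCurve k} {K : IntermediateField k Ω} (f : FunField E K) (Q : Pt E Ω)
    (c : K) : Prop :=
  ∀ v : Place K (FunField E K), LiesBelow v Q →
    v.ring.valuation (f - algebraMap K (FunField E K) c) < 1

/-- The value `f(Q)` of a rational function that is regular at the `K`-rational point `Q`
(and `0` if there is no value). -/
noncomputable def evalAt {E : WeierstrassCurve k} {K : IntermediateField k Ω} (f : FunField E K)
    (Q : Pt E Ω) : K :=
  open scoped Classical in if h : ∃ c, HasValue f Q c then h.choose else 0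

/-! ### Divisors and Riemann-Roch spaces -/

/-- Geometric divisors on `E`: formal sums of points of `E(Ω)`. -/
abbrev Divisor (E : WeierstrassCurve k) (Ω : Type*) [Field Ω] [Algebra k Ω] : Type _ :=
  Pt E Ω →₀ ℤ

/-- The divisor `(X) = ∑_{x ∈ X} x` of a finite set of points. -/
noncomputable def divisorOf {E : WeierstrassCurve k} (X : Set (Pt E Ω)) : Divisor E Ω :=
  ∑ᶠ Q ∈ X, Finsupp.single Q 1

/-- The space `L(D) = {f ∈ K(E) | div(f) + D ≥ 0}` of a divisor `D` defined over `K`: at the place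
below a geometric point `Q`, the order of `f` is at least `-D(Q)`. -/
def rrSpace {E : WeierstrassCurve k} (K : IntermediateField k Ω) (D : Divisor E Ω) :
    Submodule K (FunField E K) where
  carrier := {f | ∀ v : Place K (FunField E K), ∀ Q : Pt E Ω, LiesBelow v Q → v.OrdGE f (-D Q)}
  zero_mem' := by
    intro v Q _ π _
    rw [map_zero]
    exact zero_le
  add_mem' := by
    intro f g hf hg v Q hQ π hπ
    exact (v.ring.valuation.map_add f g).trans (max_le (hf v Q hQ π hπ) (hg v Q hQ π hπ))
  smul_mem' := by
    intro c f hf v Q hQ π hπ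
    rw [Algebra.smul_def, map_mul]
    exact (mul_le_of_le_one_left' ((v.ring.valuation_le_one_iff _).mpr (v.const_mem c))).trans
      (hf v Q hQ π hπ)

/-- The space `L_0(D) = {f ∈ L(D) | f(P) = 0}`. -/
def rrSpace₀ {E : WeierstrassCurve k} (K : IntermediateField k Ω) (D : Divisor E Ω) (P : Pt E Ω) :
    Submodule K (FunField E K) where
  carrier := {f | f ∈ rrSpace K D ∧ HasValue f P 0}
  zero_mem' := by
    refine ⟨zero_mem _, fun v _ => ?_⟩
    simp
  add_mem' := by
    rintro f g ⟨hf, hf'⟩ ⟨hg, hg'⟩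
    refine ⟨add_mem hf hg, fun v hv => ?_⟩
    have h1 := hf' v hv
    have h2 := hg' v hv
    rw [map_zero, sub_zero] at h1 h2 ⊢
    exact v.ring.valuation.map_add_lt h1 h2
  smul_mem' := by
    rintro c f ⟨hf, hf'⟩
    refine ⟨Submodule.smul_mem _ c hf, fun v hv => ?_⟩
    have h1 := hf' v hv
    rw [map_zero, sub_zero] at h1 ⊢
    rw [Algebra.smul_def, map_mul]
    exact (mul_le_of_le_one_left'
      ((v.ring.valuation_le_one_iff _).mpr (v.const_mem c))).trans_lt h1

/-- The set `Σ* = Σ \ {P}`. -/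
noncomputable def punctured {E : WeierstrassCurve k} (S : Finset (Pt E Ω)) (P : Pt E Ω) :
    Finset (Pt E Ω) :=
  open scoped Classical in S.erase P

/-- The evaluation of rational functions over `K` at the points of a finite set. -/
noncomputable def evalOn {E : WeierstrassCurve k} (K : IntermediateField k Ω)
    (S : Finset (Pt E Ω)) (f : FunField E K) : S → K :=
  fun s => evalAt f s

/-- The code `C⁰_L(D, Σ*)` over `K`, that is, the evaluation map `L_0(D) → K^{Σ*}`. -/
noncomputable def code₀ {E : WeierstrassCurve k} (K : IntermediateField k Ω) (D : Divisor E Ω)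
    (S : Finset (Pt E Ω)) (P : Pt E Ω) : rrSpace₀ K D P → punctured S P → K :=
  fun f => evalOn K (punctured S P) f

/-! ### The divisors `D_m` -/

/-- The endomorphism `τ_n = 1 + F + ⋯ + F ^ (n - 1)` of the group `E(Ω)`, where `F` is the
`q`-th power Frobenius endomorphism of `E`, `q = |k|`. -/
noncomputable def tau [Fintype k] (E : WeierstrassCurve k) (Ω : Type*) [Field Ω] [Algebra k Ω]
    [DecidableEq Ω] (n : ℕ) : AddMonoid.End (Pt E Ω) :=
  ∑ i ∈ Finset.range n,
    (show AddMonoid.End (Pt E Ω) from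
      WeierstrassCurve.Affine.Point.map (W' := E.toAffine) (FiniteField.frobeniusAlgHom k Ω)) ^ i

/-- The kernel `G_n` of `τ_n`. -/
def kernelSet [Fintype k] (E : WeierstrassCurve k) (Ω : Type*) [Field Ω] [Algebra k Ω] (n : ℕ) :
    Set (Pt E Ω) :=
  open scoped Classical in {Q | tau E Ω n Q = 0}

/-- The set `X_n`, the union of the `G_r` over the primes `r` dividing `n`. It is a finite
set, since `G_r ⊆ E(k_r)` where `k_r` is the extension of `k` of degree `r`. -/
def kernelUnion [Fintype k] (E : WeierstrassCurve k) (Ω : Type*) [Field Ω] [Algebra k Ω] (n : ℕ) :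
    Set (Pt E Ω) :=
  ⋃ r ∈ n.primeFactors, kernelSet E Ω r

/-- The divisor `D_n = (X_n)`. For a prime `r` it is `(G_r)`. -/
noncomputable def kernelDivisor [Fintype k] (E : WeierstrassCurve k) (Ω : Type*) [Field Ω]
    [Algebra k Ω] (n : ℕ) : Divisor E Ω :=
  divisorOf (kernelUnion E Ω n)

end Curve

end EllipticCode

/-! Each divisor involved is `(T) + (0)` with `T` the set of non-zero points of a finite symmetric
set `X` (`X_N` or some `G_r`), apart from the zero divisor when `X` is empty. For a point `Q ≠ 0`
the function `poleFn Q = (Y - y(-Q)) / (X - x(Q))` has simple poles exactly at `Q` and at infinity.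
Together with the constant `1` these functions span `L(D)` (`mem_span_poleFn`): subtracting
multiples of them removes all affine poles, and no function has a single simple pole at infinity as
its only pole. Normalized to vanish at `P`, they form a basis of `L_0(D)`, which therefore has
dimension `|T|` (`rrSpace₀_eq_span`, `finrank_rrSpace₀`).

A non-zero `f` in `L_0(D)` has at most `|T| + 1` zeros in `Σ`, including `P`. If it has exactly that
many, the zeros and the poles have the same sum in the group `E` (`card_zeros_le`). Hence, if no
non-empty subset of `Σ` has the same sum as `X`, a non-zero codeword has fewer than `|T|` zeros,
which for a code of dimension `|T|` is the MDS property (`isMDS_of_card_zeros_lt`, `isMDS_code₀`).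
Such a `Σ` is built greedily, since `E(Ω)` is infinite and each new point has only finitely many
values to avoid (`exists_finset_sum_notMem`); `K` is then generated over `k_N` by coordinates.

For the direct sum, a point of `G_r ∩ G_s` with `r ≠ s` prime is fixed by `F ^ r` and `F ^ s`, hence
by `F`; so it is killed by `r` and by `s`, and is zero (`kernelSet_inter_eq_zero`). The bases of the
`L_0(D_r)` are thus disjoint pieces of the basis of `L_0(D_N)`.

Two facts replace intersection theory on the curve: the coordinate ring is Dedekind, so affine
places have uniformizers, and the pole order at infinity of a regular function `r` is the degree of
its norm to `K[X]`, which is also the dimension of the quotient by `(r)`. -/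

namespace EllipticCode

/-! ### Places of a field, their uniformizers and their centers on a subring -/

section Places

variable {K F : Type*} [Field K] [Field F] [Algebra K F]

/-- `t` is a uniformizer of the place `v`. -/
def Place.IsUniformizer (v : Place K F) (t : F) : Prop :=
  v.ring.valuation t < 1 ∧ ∀ h : F, v.ring.valuation h < 1 → v.ring.valuation h ≤ v.ring.valuation t

theorem Place.exists_ne_zero (v : Place K F) : ∃ h : F, h ≠ 0 ∧ v.ring.valuation h < 1 := by
  by_contra! H
  refine v.ne_top (eq_top_iff.mpr fun f _ => ?_)
  by_cases hf : f = 0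
  · rw [hf]; exact zero_mem _
  · rw [← v.ring.valuation_le_one_iff]
    have := H f⁻¹ (inv_ne_zero hf)
    rw [map_inv₀] at this
    exact (one_le_inv₀ ((Valuation.pos_iff _).mpr hf)).mp this

theorem Place.IsUniformizer.ne_zero {v : Place K F} {t : F} (ht : v.IsUniformizer t) : t ≠ 0 := by
  rintro rfl
  obtain ⟨h, h0, h1⟩ := v.exists_ne_zero
  have := ht.2 h h1
  rw [map_zero, le_zero_iff, map_eq_zero] at this
  exact h0 this

theorem Place.IsUniformizer.pos {v : Place K F} {t : F} (ht : v.IsUniformizer t) :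
    0 < v.ring.valuation t := (Valuation.pos_iff _).mpr ht.ne_zero

/-- If `f` had a pole, `f⁻¹` would lie in the maximal ideal and so be no larger than `t`. This is
the discreteness of the valuation: a pole of order less than one is no pole. -/
theorem Place.IsUniformizer.one_le_of_lt {v : Place K F} {t : F} (ht : v.IsUniformizer t) {f : F}
    (hf : v.ring.valuation f < (v.ring.valuation t)⁻¹) : v.ring.valuation f ≤ 1 := by
  by_contra! h
  have hpos : 0 < v.ring.valuation f := zero_lt_one.trans h
  have h1 := ht.2 f⁻¹ (by rw [map_inv₀]; exact inv_lt_one_of_one_lt₀ h)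
  rw [map_inv₀] at h1
  exact absurd hf (not_lt.mpr ((inv_le_comm₀ hpos ht.pos).mp h1))

/-- `OrdGE` quantifies over all generators of the maximal ideal, so it is vacuous if there are none.
A uniformizer is a generator, and all generators have its valuation. -/
theorem Place.IsUniformizer.ordGE_iff {v : Place K F} {t : F} (ht : v.IsUniformizer t) (f : F)
    (n : ℤ) : v.OrdGE f n ↔ v.ring.valuation f ≤ v.ring.valuation t ^ n := by
  constructor
  · intro h
    refine h ⟨t, (v.ring.valuation_le_one_iff t).mp ht.1.le⟩ (le_antisymm ?_ ?_)
    · intro a ha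
      have h1 := ht.2 a ((v.ring.valuation_lt_one_iff a).mp ha)
      rw [Ideal.mem_span_singleton]
      refine ⟨⟨(a : F) * t⁻¹, (v.ring.valuation_le_one_iff _).mp ?_⟩, ?_⟩
      · rw [map_mul, map_inv₀]
        exact (div_le_one₀ ht.pos).mpr h1
      · ext
        simp [mul_comm, ht.ne_zero]
    · rw [Ideal.span_singleton_le_iff_mem, v.ring.valuation_lt_one_iff]
      exact ht.1
  · intro h π hπ
    have e : v.ring.valuation (π : F) = v.ring.valuation t := by
      refine le_antisymm (ht.2 _ ?_) ?_
      · rw [← v.ring.valuation_lt_one_iff, hπ]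
        exact Ideal.mem_span_singleton_self π
      · have : (⟨t, (v.ring.valuation_le_one_iff t).mp ht.1.le⟩ : v.ring) ∈
            IsLocalRing.maximalIdeal v.ring := by
          rw [v.ring.valuation_lt_one_iff]; exact ht.1
        rw [hπ, Ideal.mem_span_singleton] at this
        obtain ⟨c, hc⟩ := this
        have hc' : t = π * c := congrArg Subtype.val hc
        rw [hc', map_mul]
        exact mul_le_of_le_one_right' ((v.ring.valuation_le_one_iff _).mpr c.2)
    rwa [e]

theorem Place.ordGE_of_le_one {v : Place K F} {f : F} (hf : v.ring.valuation f ≤ 1) {n : ℤ}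
    (hn : n ≤ 0) : v.OrdGE f n := by
  intro π hπ
  have h1 : v.ring.valuation (π : F) ≤ 1 := (v.ring.valuation_le_one_iff _).mpr π.2
  have h0 : 0 < v.ring.valuation (π : F) := by
    obtain ⟨h, h0, h1⟩ := v.exists_ne_zero
    rw [Valuation.pos_iff]
    intro hz
    have : (⟨h, (v.ring.valuation_le_one_iff h).mp h1.le⟩ : v.ring) ∈
        IsLocalRing.maximalIdeal v.ring := by
      rw [v.ring.valuation_lt_one_iff]; exact h1
    rw [hπ, Ideal.mem_span_singleton] at this
    obtain ⟨c, hc⟩ := this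
    have hc' : h = π * c := congrArg Subtype.val hc
    rw [hz, zero_mul] at hc'
    exact h0 hc'
  exact hf.trans (one_le_zpow_of_nonpos₀ h0 h1 hn)

theorem Place.valuation_algebraMap (v : Place K F) {c : K} (hc : c ≠ 0) :
    v.ring.valuation (algebraMap K F c) = 1 := by
  refine le_antisymm ((v.ring.valuation_le_one_iff _).mpr (v.const_mem c)) ?_
  have h := (v.ring.valuation_le_one_iff _).mpr (v.const_mem c⁻¹)
  rw [map_inv₀, map_inv₀] at h
  exact (inv_le_one₀ ((Valuation.pos_iff _).mpr (by simpa using hc))).mp h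

theorem Place.eq_of_valuation_sub_lt_one (v : Place K F) {f : F} {c c' : K}
    (h : v.ring.valuation (f - algebraMap K F c) < 1)
    (h' : v.ring.valuation (f - algebraMap K F c') < 1) : c = c' := by
  by_contra hne
  have h2 := v.valuation_algebraMap (sub_ne_zero.mpr (Ne.symm hne))
  have := v.ring.valuation.map_sub_lt h h'
  rw [sub_sub_sub_cancel_left, ← map_sub, h2] at this
  exact lt_irrefl _ this

variable {R : Type*} [CommRing R] [Algebra R F]

/-- The place `v` is centered at the prime `m` of the ring `R`. -/
def Place.IsCenter (v : Place K F) (m : Ideal R) : Prop :=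
  ∀ r : R, algebraMap R F r ∈ v.ring ∧ (v.ring.valuation (algebraMap R F r) < 1 ↔ r ∈ m)

theorem Place.IsCenter.valuation_eq_one {v : Place K F} {m : Ideal R} (hc : v.IsCenter m) {r : R}
    (hr : r ∉ m) : v.ring.valuation (algebraMap R F r) = 1 :=
  le_antisymm ((v.ring.valuation_le_one_iff _).mpr (hc r).1)
    (not_lt.mp fun h => hr ((hc r).2.mp h))

variable [IsFractionRing R F]

/-- Every maximal ideal is the center of a place. -/
theorem Place.exists_isCenter [Algebra K R] [IsScalarTower K R F] (m : Ideal R) [hm : m.IsMaximal]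
    (h0 : m ≠ ⊥) : ∃ v : Place K F, v.IsCenter m := by
  have hinj : Function.Injective (algebraMap R F) := IsFractionRing.injective R F
  let e : R ≃+* (algebraMap R F).range := RingEquiv.ofBijective (algebraMap R F).rangeRestrict
    ⟨fun a b h => hinj (congrArg Subtype.val h), (algebraMap R F).rangeRestrict_surjective⟩
  have hne : m.map e ≠ ⊤ := by
    intro h
    have := congrArg (Ideal.comap e) h
    rw [Ideal.comap_map_of_bijective _ e.bijective, Ideal.comap_top] at this
    exact hm.ne_top this
  -- Chevalley's extension theorem: a proper ideal of a subring lies in the non-units of some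
  -- valuation ring that contains the subring.
  obtain ⟨B, hB, hI⟩ := Ideal.image_subset_nonunits_valuationSubring _ hne
  have hR : ∀ r : R, algebraMap R F r ∈ B := fun r => hB ⟨r, rfl⟩
  have hmem : ∀ r ∈ m, B.valuation (algebraMap R F r) < 1 := by
    intro r hr
    have : algebraMap R F r ∈ B.nonunits := hI ⟨e r, Ideal.mem_map_of_mem _ hr, rfl⟩
    exact this
  refine ⟨⟨B, fun c => ?_, ?_⟩, fun r => ⟨hR r, ⟨fun h => ?_, hmem r⟩⟩⟩
  · rw [IsScalarTower.algebraMap_apply K R F]; exact hR _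
  · rintro rfl
    obtain ⟨a, ha, ha0⟩ := Submodule.exists_mem_ne_zero_of_ne_bot h0
    have h1 := hmem a ha
    have h2 : (⊤ : ValuationSubring F).valuation (algebraMap R F a)⁻¹ ≤ 1 :=
      (ValuationSubring.valuation_le_one_iff _ _).mpr trivial
    rw [map_inv₀] at h2
    have h3 := (inv_le_one₀ ((Valuation.pos_iff _).mpr
      (by rwa [Ne, map_eq_zero_iff _ hinj]))).mp h2
    exact absurd h1 (not_lt.mpr h3)
  · by_contra hr
    obtain ⟨s, i, hi, e1⟩ := hm.exists_inv hr
    have h1 : B.valuation (algebraMap R F (s * r + i)) < 1 := by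
      rw [map_add, map_mul]
      refine Valuation.map_add_lt _ ?_ (hmem i hi)
      rw [map_mul]
      exact (mul_le_of_le_one_left' ((B.valuation_le_one_iff _).mpr (hR s))).trans_lt h
    rw [e1, map_one, map_one] at h1
    exact lt_irrefl _ h1

variable [IsDomain R]

/-- Numerator and denominator of `h` are comparable for divisibility in the localization; clearing
the denominator of the quotient leaves an identity in `R`. -/
theorem exists_mul_eq_of_valuationRing_localization (m : Ideal R) [m.IsPrime]
    [ValuationRing (Localization.AtPrime m)] (h : F) :
    (∃ a b : R, b ∉ m ∧ h * algebraMap R F b = algebraMap R F a) ∨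
      ∃ a ∈ m, ∃ b ∉ m, h * algebraMap R F a = algebraMap R F b := by
  obtain ⟨p, q, hq, rfl⟩ := IsFractionRing.div_surjective (A := R) h
  have hq0 : algebraMap R F q ≠ 0 := IsFractionRing.to_map_ne_zero_of_mem_nonZeroDivisors hq
  have key : ∀ x y : R, algebraMap R (Localization.AtPrime m) x ∣ algebraMap R _ y →
      ∃ a b : R, b ∉ m ∧ y * b = x * a := by
    rintro x y ⟨c, hc⟩
    obtain ⟨a, b, rfl⟩ := IsLocalization.exists_mk'_eq m.primeCompl c
    refine ⟨a, b, b.2, IsLocalization.injective (Localization.AtPrime m)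
      m.primeCompl_le_nonZeroDivisors ?_⟩
    rw [map_mul, hc, mul_assoc, IsLocalization.mk'_spec, map_mul]
  rcases ValuationRing.dvd_total (algebraMap R (Localization.AtPrime m) q)
    (algebraMap R (Localization.AtPrime m) p) with h1 | h1
  · obtain ⟨a, b, hb, e⟩ := key _ _ h1
    refine Or.inl ⟨a, b, hb, ?_⟩
    rw [div_mul_eq_mul_div, div_eq_iff hq0, ← map_mul, e, map_mul, mul_comm]
  · obtain ⟨a, b, hb, e⟩ := key _ _ h1
    have e2 : algebraMap R F p / algebraMap R F q * algebraMap R F a = algebraMap R F b := by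
      rw [div_mul_eq_mul_div, div_eq_iff hq0, ← map_mul, ← e, map_mul, mul_comm]
    by_cases ha : a ∈ m
    · exact Or.inr ⟨a, ha, b, hb, e2⟩
    · exact Or.inl ⟨b, a, ha, e2⟩

theorem Place.IsCenter.exists_mul_eq {v : Place K F} {m : Ideal R} [m.IsPrime]
    [ValuationRing (Localization.AtPrime m)] (hc : v.IsCenter m) {h : F}
    (hh : v.ring.valuation h ≤ 1) :
    ∃ a b : R, b ∉ m ∧ h * algebraMap R F b = algebraMap R F a := by
  refine (exists_mul_eq_of_valuationRing_localization m h).resolve_right ?_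
  rintro ⟨a, ha, b, hb, e⟩
  have h1 := (hc a).2.mpr ha
  have h2 := hc.valuation_eq_one hb
  rw [← e, map_mul] at h2
  exact absurd h2 ((mul_le_of_le_one_left' hh).trans_lt h1).ne

/-- It suffices to test on `m`: an element of the maximal ideal of `v` is `a / b` with `b ∉ m`, and
such a `b` has valuation one. -/
theorem Place.IsCenter.isUniformizer {v : Place K F} {m : Ideal R} [m.IsPrime]
    [ValuationRing (Localization.AtPrime m)] (hc : v.IsCenter m) {t : F}
    (ht : v.ring.valuation t < 1)
    (hm : ∀ a ∈ m, v.ring.valuation (algebraMap R F a) ≤ v.ring.valuation t) :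
    v.IsUniformizer t := by
  refine ⟨ht, fun h hh => ?_⟩
  obtain ⟨a, b, hb, e⟩ := hc.exists_mul_eq hh.le
  have e1 : v.ring.valuation h = v.ring.valuation (algebraMap R F a) := by
    rw [← e, map_mul, hc.valuation_eq_one hb, mul_one]
  rw [e1] at hh ⊢
  exact hm a ((hc a).2.mp hh)

theorem Place.IsCenter.exists_isUniformizer {v : Place K F} {m : Ideal R} [m.IsPrime]
    [ValuationRing (Localization.AtPrime m)]
    (hm : (IsLocalRing.maximalIdeal (Localization.AtPrime m)).IsPrincipal)
    (hc : v.IsCenter m) : ∃ t, v.IsUniformizer t := by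
  obtain ⟨⟨ϖ, hϖ⟩⟩ := hm
  obtain ⟨u, w, rfl⟩ := IsLocalization.exists_mk'_eq m.primeCompl ϖ
  have hu : u ∈ m := by
    have : IsLocalization.mk' (Localization.AtPrime m) u w ∈ IsLocalRing.maximalIdeal _ := by
      rw [hϖ]; exact Submodule.mem_span_singleton_self _
    exact (IsLocalization.AtPrime.mk'_mem_maximal_iff _ m u w).mp this
  refine ⟨algebraMap R F u, hc.isUniformizer ((hc u).2.mpr hu) fun a ha => ?_⟩
  have h1 : algebraMap R (Localization.AtPrime m) a ∈ IsLocalRing.maximalIdeal _ :=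
    (IsLocalization.AtPrime.to_map_mem_maximal_iff _ m a).mpr ha
  rw [hϖ, Submodule.mem_span_singleton] at h1
  obtain ⟨c, hc'⟩ := h1
  obtain ⟨b, s, rfl⟩ := IsLocalization.exists_mk'_eq m.primeCompl c
  rw [smul_eq_mul, ← IsLocalization.mk'_mul, IsLocalization.mk'_eq_iff_eq_mul, ← map_mul] at hc'
  have h2 := IsLocalization.injective (Localization.AtPrime m)
      m.primeCompl_le_nonZeroDivisors hc'
  have h3 := congrArg (fun r => v.ring.valuation (algebraMap R F r)) h2
  simp only [map_mul, Submonoid.coe_mul, hc.valuation_eq_one s.2, hc.valuation_eq_one w.2,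
    mul_one] at h3
  rw [← h3]
  exact mul_le_of_le_one_left' ((v.ring.valuation_le_one_iff _).mpr (hc b).1)

/-- A place containing `R` has a nonzero prime center. -/
theorem Place.exists_center (v : Place K F) (hv : ∀ r : R, algebraMap R F r ∈ v.ring) :
    ∃ m : Ideal R, m.IsPrime ∧ m ≠ ⊥ ∧ v.IsCenter m := by
  let φ : R →+* v.ring := (algebraMap R F).codRestrict v.ring hv
  have hc : v.IsCenter ((IsLocalRing.maximalIdeal v.ring).comap φ) := by
    intro r
    refine ⟨hv r, ?_⟩
    rw [Ideal.mem_comap, v.ring.valuation_lt_one_iff]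
    rfl
  refine ⟨_, inferInstance, fun hbot => ?_, hc⟩
  -- With zero center every non-zero element of `R` would have valuation one, and `v` would be
  -- trivial on the fraction field.
  obtain ⟨h, h0, h1⟩ := v.exists_ne_zero
  obtain ⟨p, q, hq, rfl⟩ := IsFractionRing.div_surjective (A := R) h
  have hp : p ≠ 0 := by rintro rfl; simp at h0
  rw [hbot] at hc
  rw [map_div₀, hc.valuation_eq_one (by simpa using hp),
    hc.valuation_eq_one (by simpa using nonZeroDivisors.ne_zero hq), div_one] at h1
  exact lt_irrefl _ h1

end Places

theorem isPrincipal_maximalIdeal_localization {R : Type*} [CommRing R] {m : Ideal R} [m.IsPrime]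
    {u c : R} (hu : u ∈ m) (hc : c ∉ m) (h : ∀ a ∈ m, ∃ b, a * c = u * b) :
    (IsLocalRing.maximalIdeal (Localization.AtPrime m)).IsPrincipal := by
  refine ⟨⟨algebraMap R _ u, le_antisymm (fun z hz => ?_) ?_⟩⟩
  · obtain ⟨a, s, rfl⟩ := IsLocalization.exists_mk'_eq m.primeCompl z
    obtain ⟨b, hb⟩ := h a ((IsLocalization.AtPrime.mk'_mem_maximal_iff _ m a s).mp hz)
    rw [Submodule.mem_span_singleton]
    refine ⟨IsLocalization.mk' _ b (s * ⟨c, hc⟩), ?_⟩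
    rw [smul_eq_mul, mul_comm, IsLocalization.mul_mk'_eq_mk'_of_mul, ← hb]
    exact IsLocalization.mk'_cancel a s ⟨c, hc⟩
  · rw [Submodule.span_singleton_le_iff_mem]
    exact (IsLocalization.AtPrime.to_map_mem_maximal_iff _ m u).mpr hu

/-! ### The affine coordinate ring of an elliptic curve is a Dedekind domain -/

section CoordinateRing

open WeierstrassCurve WeierstrassCurve.Affine

variable {K : Type*} [Field K] (W : WeierstrassCurve.Affine K)

instance finite_coordinateRing : Module.Finite K[X] W.CoordinateRing :=
  Module.Finite.of_basis (CoordinateRing.basis W)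

instance isNoetherianRing_coordinateRing : IsNoetherianRing W.CoordinateRing :=
  IsNoetherianRing.of_finite K[X] W.CoordinateRing

instance finiteType_coordinateRing : Algebra.FiniteType K W.CoordinateRing :=
  (inferInstance : Algebra.FiniteType K K[X]).trans inferInstance

instance dimensionLEOne_coordinateRing : Ring.DimensionLEOne W.CoordinateRing where
  maximalOfPrime {p} hp hprime := by
    refine Ideal.isMaximal_of_isIntegral_of_isMaximal_comap (R := K[X]) p ?_
    refine Ideal.IsPrime.isMaximal inferInstance fun h => hp ?_
    exact Ideal.eq_bot_of_comap_eq_bot h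

variable {W}

theorem mk_mem_XYIdeal_iff {x y : K} (h : W.Equation x y) (p : K[X][X]) :
    CoordinateRing.mk W p ∈ CoordinateRing.XYIdeal W x (C y) ↔ p.evalEval x y = 0 := by
  have e : CoordinateRing.XYIdeal W x (C y) =
      (Ideal.span {C (X - C x), X - C (C y)} : Ideal K[X][X]).map (CoordinateRing.mk W) := by
    rw [Ideal.map_span, Set.image_pair]
    rfl
  rw [e, Ideal.mem_map_iff_of_surjective _ AdjoinRoot.mk_surjective]
  constructor
  · rintro ⟨q, hq, hqp⟩
    rw [mem_span_C_X_sub_C_X_sub_C_iff_eval_eval_eq_zero] at hq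
    obtain ⟨r, hr⟩ := AdjoinRoot.mk_eq_mk.mp hqp
    have := congrArg (evalEval x y) hr
    rw [evalEval_sub, evalEval_mul, h, zero_mul, evalEval, hq, zero_sub, neg_eq_zero] at this
    exact this
  · intro hp
    exact ⟨p, mem_span_C_X_sub_C_X_sub_C_iff_eval_eval_eq_zero.mpr hp, rfl⟩

theorem XYIdeal_isMaximal {x y : K} (h : W.Equation x y) :
    (CoordinateRing.XYIdeal W x (C y)).IsMaximal := by
  apply Ideal.Quotient.maximal_of_isField
  exact (CoordinateRing.quotientXYIdealEquiv (W' := W) (x := x) (y := C y) h).toMulEquiv.isField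
    (Field.toIsField K)

theorem XYIdeal_ne_bot (x y : K) : CoordinateRing.XYIdeal W x (C y) ≠ ⊥ := by
  intro h
  have : CoordinateRing.XClass W x ∈ CoordinateRing.XYIdeal W x (C y) :=
    Ideal.subset_span (by simp)
  rw [h, Ideal.mem_bot] at this
  exact CoordinateRing.XClass_ne_zero x this

variable (W) in
/-- The cofactor `H` in `(Y - y)(Y - y') = (X - x) H`, where `(x, y')` is the opposite of the
point `(x, y)` of the curve. -/
noncomputable def cofactor (x : K) : K[X][X] :=
  C (X ^ 2 + C (x + W.a₂) * X + C (x ^ 2 + W.a₂ * x + W.a₄)) - C (C W.a₁) * X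

/-- Over `X = x` the Weierstrass equation is a quadratic in `Y` with roots `y` and `negY x y`.
Subtracting its value at the point leaves a multiple of `X - x`. -/
theorem mk_sub_mul_sub {x y : K} (h : W.Equation x y) :
    CoordinateRing.mk W (X - C (C y)) * CoordinateRing.mk W (X - C (C (W.negY x y))) =
      CoordinateRing.mk W (C (X - C x)) * CoordinateRing.mk W (cofactor W x) := by
  rw [← map_mul, ← map_mul, AdjoinRoot.mk_eq_mk]
  refine ⟨1, ?_⟩
  linear_combination (norm := skip) congr_arg C (congr_arg C ((equation_iff ..).mp h).symm)
  rw [negY, polynomial, cofactor]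
  simp only [C_neg, C_add, C_sub, C_mul, C_pow]
  ring1

/-- Up to sign, the two quantities are the partial derivatives of the Weierstrass polynomial at the
point. -/
theorem cofactor_ne_zero_or {x y : K} (h : W.Nonsingular x y) :
    (cofactor W x).evalEval x y ≠ 0 ∨ y ≠ W.negY x y := by
  rcases ((nonsingular_iff' ..).mp h).right with hx | hy
  · left
    contrapose! hx
    rw [← neg_eq_zero, ← hx]
    simp [cofactor, evalEval]
    ring
  · right
    contrapose! hy
    rw [negY] at hy
    linear_combination hy

theorem exists_mk_mul_of_mem_XYIdeal {x y : K} {a : W.CoordinateRing}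
    (ha : a ∈ CoordinateRing.XYIdeal W x (C y)) :
    ∃ b c, a = b * CoordinateRing.mk W (C (X - C x)) + c * CoordinateRing.mk W (X - C (C y)) := by
  obtain ⟨b, c, h⟩ := Ideal.mem_span_pair.mp ha
  exact ⟨b, c, h.symm⟩

/-- In `(Y - y)(Y - y') = (X - x) H` one of `H` and `Y - y'` is a unit at a nonsingular point.
Accordingly `Y - y` or `X - x` divides the other and generates the maximal ideal. -/
theorem isPrincipal_maximalIdeal_localization_XYIdeal {x y : K} (h : W.Nonsingular x y)
    [hp : (CoordinateRing.XYIdeal W x (C y)).IsPrime] :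
    (IsLocalRing.maximalIdeal
      (Localization.AtPrime (CoordinateRing.XYIdeal W x (C y)))).IsPrincipal := by
  have hX : CoordinateRing.mk W (C (X - C x)) ∈ CoordinateRing.XYIdeal W x (C y) := by
    rw [mk_mem_XYIdeal_iff h.1]; simp [evalEval]
  have hY : CoordinateRing.mk W (X - C (C y)) ∈ CoordinateRing.XYIdeal W x (C y) := by
    rw [mk_mem_XYIdeal_iff h.1]; simp [evalEval]
  have key := mk_sub_mul_sub h.1
  rcases cofactor_ne_zero_or h with h1 | h1
  · refine isPrincipal_maximalIdeal_localization hY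
      (c := CoordinateRing.mk W (cofactor W x)) ?_ fun a ha => ?_
    · rwa [mk_mem_XYIdeal_iff h.1]
    · obtain ⟨b, c, rfl⟩ := exists_mk_mul_of_mem_XYIdeal ha
      exact ⟨b * CoordinateRing.mk W (X - C (C (W.negY x y))) +
        c * CoordinateRing.mk W (cofactor W x),
        by linear_combination -b * key⟩
  · refine isPrincipal_maximalIdeal_localization hX
      (c := CoordinateRing.mk W (X - C (C (W.negY x y)))) ?_
      fun a ha => ?_
    · rw [mk_mem_XYIdeal_iff h.1]
      simpa [sub_eq_zero] using h1
    · obtain ⟨b, c, rfl⟩ := exists_mk_mul_of_mem_XYIdeal ha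
      exact ⟨b * CoordinateRing.mk W (X - C (C (W.negY x y))) +
        c * CoordinateRing.mk W (cofactor W x),
        by linear_combination c * key⟩

theorem isPrincipalIdealRing_localization_XYIdeal {x y : K} (h : W.Nonsingular x y)
    [(CoordinateRing.XYIdeal W x (C y)).IsPrime] :
    IsPrincipalIdealRing (Localization.AtPrime (CoordinateRing.XYIdeal W x (C y))) :=
  have := IsLocalization.isNoetherianRing (CoordinateRing.XYIdeal W x (C y)).primeCompl
    (Localization.AtPrime (CoordinateRing.XYIdeal W x (C y))) inferInstance
  ((tfae_of_isNoetherianRing_of_isLocalRing_of_isDomain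
    (Localization.AtPrime (CoordinateRing.XYIdeal W x (C y)))).out 4 0).mp
    (isPrincipal_maximalIdeal_localization_XYIdeal h)

/-- Every maximal ideal of the coordinate ring is the ideal of a point over an algebraically closed
extension. -/
theorem exists_point_of_isMaximal (Ω : Type*) [Field Ω] [Algebra K Ω] [IsAlgClosed Ω]
    (m : Ideal W.CoordinateRing) [m.IsMaximal] :
    ∃ x y : Ω, (W.map (algebraMap K Ω)).Equation x y ∧ ∀ p : K[X][X],
      CoordinateRing.mk W p ∈ m ↔ (p.map (mapRingHom (algebraMap K Ω))).evalEval x y = 0 := by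
  let _ : Field (W.CoordinateRing ⧸ m) := Ideal.Quotient.field m
  have : Algebra.FiniteType K (W.CoordinateRing ⧸ m) := inferInstance
  have : Module.Finite K (W.CoordinateRing ⧸ m) := finite_of_finite_type_of_isJacobsonRing _ _
  let φ : (W.CoordinateRing ⧸ m) →ₐ[K] Ω := IsAlgClosed.lift
  let ψ : W.CoordinateRing →ₐ[K] Ω := φ.comp (Ideal.Quotient.mkₐ K m)
  have hψ : ∀ r, r ∈ m ↔ ψ r = 0 := by
    intro r
    rw [← Ideal.Quotient.eq_zero_iff_mem, ← map_eq_zero_iff φ φ.injective]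
    rfl
  have key : ∀ p : K[X][X], ψ (CoordinateRing.mk W p) =
      (p.map (mapRingHom (algebraMap K Ω))).evalEval
      (ψ (CoordinateRing.mk W (C X))) (ψ (CoordinateRing.mk W X)) := by
    intro p
    have : (ψ : W.CoordinateRing →+* Ω).comp (CoordinateRing.mk W) =
        (evalEvalRingHom (ψ (CoordinateRing.mk W (C X)))
        (ψ (CoordinateRing.mk W X))).comp (mapRingHom (mapRingHom (algebraMap K Ω))) := by
      refine Polynomial.ringHom_ext' (Polynomial.ringHom_ext' (RingHom.ext fun c => ?_) ?_) ?_
      · exact (ψ.commutes c).trans (by simp)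
      · simp
      · simp
    simpa using congrArg (fun f => f p) this
  refine ⟨ψ (CoordinateRing.mk W (C X)), ψ (CoordinateRing.mk W X), ?_, fun p => ?_⟩
  · rw [Equation, map_polynomial, ← key, AdjoinRoot.mk_self, map_zero]
  · rw [hψ, key]

/-- By the Nullstellensatz every maximal ideal is that of a point. Its localization is a principal
ideal domain, and being integrally closed is a local property. -/
theorem isIntegrallyClosed_coordinateRing_of_isAlgClosed [IsAlgClosed K] [W.IsElliptic] :
    IsIntegrallyClosed W.CoordinateRing := by
  refine IsIntegrallyClosed.of_localization_maximal fun m hm _ => ?_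
  obtain ⟨x, y, h, hm'⟩ := exists_point_of_isMaximal K m
  have hid : W.map (algebraMap K K) = W := WeierstrassCurve.map_id W
  rw [hid] at h
  have e : m = CoordinateRing.XYIdeal W x (C y) := by
    ext r
    obtain ⟨p, rfl⟩ := AdjoinRoot.mk_surjective r
    rw [mk_mem_XYIdeal_iff h]
    refine (hm' p).trans ?_
    simp
  subst e
  have := isPrincipalIdealRing_localization_XYIdeal ((equation_iff_nonsingular).mp h)
  infer_instance

/-- Divisibility by a polynomial in `X` can be read off coordinatewise in the basis `1, Y`, which is
compatible with extension of the base field. -/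
theorem map_dvd_iff_of_polynomial {L : Type*} [Field L] [Algebra K L] (d : K[X])
    (a : W.CoordinateRing)
    (h : algebraMap L[X] _ (d.map (algebraMap K L)) ∣ CoordinateRing.map W (algebraMap K L) a) :
    algebraMap K[X] _ d ∣ a := by
  obtain ⟨z, hz⟩ := h
  obtain ⟨p, q, rfl⟩ := CoordinateRing.exists_smul_basis_eq a
  obtain ⟨p', q', rfl⟩ := CoordinateRing.exists_smul_basis_eq z
  rw [← Algebra.smul_def, map_add, CoordinateRing.map_smul, CoordinateRing.map_smul, map_one,
    CoordinateRing.map_mk, Polynomial.map_X, smul_add, ← mul_smul, ← mul_smul, ← sub_eq_zero,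
    add_sub_add_comm, ← sub_smul, ← sub_smul] at hz
  obtain ⟨h1, h2⟩ := CoordinateRing.smul_basis_eq_zero hz
  have h1' : d ∣ p := (Polynomial.map_dvd_map' (algebraMap K L)).mp ⟨p', sub_eq_zero.mp h1⟩
  have h2' : d ∣ q := (Polynomial.map_dvd_map' (algebraMap K L)).mp ⟨q', sub_eq_zero.mp h2⟩
  obtain ⟨p₁, rfl⟩ := h1'
  obtain ⟨q₁, rfl⟩ := h2'
  refine ⟨p₁ • 1 + q₁ • CoordinateRing.mk W X, ?_⟩
  rw [← Algebra.smul_def, smul_add, ← mul_smul, ← mul_smul]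

theorem map_dvd_map_of_isIntegral_div {A B : Type*} [CommRing A] [IsDomain A] [CommRing B]
    [IsDomain B] [IsIntegrallyClosed B] {g : A →+* B} (hg : Function.Injective g) {a b : A}
    (hb : b ≠ 0) (h : IsIntegral A
      (algebraMap A (FractionRing A) a / algebraMap A (FractionRing A) b)) : g b ∣ g a := by
  let G : FractionRing A →+* FractionRing B := IsFractionRing.map (A := A) (B := B) hg
  have hG : ∀ r, G (algebraMap _ _ r) = algebraMap _ _ (g r) := fun r => IsLocalization.map_eq _ r
  have hint := IsIntegral.map_of_comp_eq g G (RingHom.ext fun r => (hG r).symm) h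
  obtain ⟨z, hz⟩ := (isIntegrallyClosed_iff (FractionRing B)).mp inferInstance hint
  have hinj := IsFractionRing.injective B (FractionRing B)
  refine ⟨z, hinj ?_⟩
  rw [map_mul, hz, map_div₀, hG, hG, mul_div_cancel₀]
  rwa [Ne, map_eq_zero_iff _ hinj, map_eq_zero_iff _ hg]

/-- Descent from the algebraic closure. For `a / b` integral, write `d = b c` with `d` a polynomial
in `X`. Over the closure `b` divides `a`, so `d` divides `a c`; this divisibility descends, and `a /
b = a c / d`. -/
theorem isIntegrallyClosed_coordinateRing [W.IsElliptic] :
    IsIntegrallyClosed W.CoordinateRing := by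
  let Ω := AlgebraicClosure K
  let W' : WeierstrassCurve.Affine Ω := W.map (algebraMap K Ω)
  have : W'.IsElliptic := inferInstanceAs ((WeierstrassCurve.map W (algebraMap K Ω)).IsElliptic)
  have hΩ : IsIntegrallyClosed W'.CoordinateRing :=
    isIntegrallyClosed_coordinateRing_of_isAlgClosed
  let g : W.CoordinateRing →+* W'.CoordinateRing := CoordinateRing.map W (algebraMap K Ω)
  have hg : Function.Injective g := CoordinateRing.map_injective (algebraMap K Ω).injective
  rw [isIntegrallyClosed_iff W.FunctionField]
  intro h hh
  obtain ⟨a, b, hb, rfl⟩ := IsFractionRing.div_surjective (A := W.CoordinateRing) h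
  have hb0 : b ≠ 0 := nonZeroDivisors.ne_zero hb
  obtain ⟨d, hd, hdb⟩ := (Algebra.IsAlgebraic.isAlgebraic (R := K[X]) b).exists_nonzero_dvd hb
  obtain ⟨c, hc⟩ := hdb
  have hd0 : algebraMap K[X] W.CoordinateRing d ≠ 0 := by
    rwa [Ne, map_eq_zero_iff _ (FaithfulSMul.algebraMap_injective K[X] W.CoordinateRing)]
  obtain ⟨z, hz⟩ := map_dvd_map_of_isIntegral_div hg hb0 hh
  have hdvd : algebraMap K[X] _ d ∣ a * c := by
    refine map_dvd_iff_of_polynomial (L := Ω) d (a * c) ⟨z, ?_⟩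
    have e1 : g (algebraMap K[X] _ d) = algebraMap (Polynomial Ω) _ (d.map (algebraMap K Ω)) := by
      rw [Algebra.algebraMap_eq_smul_one, Algebra.algebraMap_eq_smul_one]
      simp only [g]
      rw [CoordinateRing.map_smul, map_one]
    rw [← e1, hc]
    change g (a * c) = _
    rw [map_mul, map_mul, hz]
    ring
  obtain ⟨y, hy⟩ := hdvd
  refine ⟨y, ?_⟩
  have hinj := IsFractionRing.injective W.CoordinateRing W.FunctionField
  rw [eq_div_iff (by rwa [Ne, map_eq_zero_iff _ hinj]), ← map_mul]
  congr 1
  have hc0 : c ≠ 0 := by rintro rfl; rw [mul_zero] at hc; exact hd0 hc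
  apply mul_right_cancel₀ hc0
  rw [hy, hc]; ring

instance isDedekindDomain_coordinateRing [W.IsElliptic] : IsDedekindDomain W.CoordinateRing :=
  have := isIntegrallyClosed_coordinateRing (W := W)
  { (inferInstance : IsDomain W.CoordinateRing), isNoetherianRing_coordinateRing W,
    dimensionLEOne_coordinateRing W, this with }

end CoordinateRing

/-! ### The place at infinity: pole orders and the uniformizer `X / Y` -/

section Infinity

open WeierstrassCurve WeierstrassCurve.Affine

variable {K : Type*} [Field K] (W : WeierstrassCurve.Affine K)

/-- The rational function on the curve given by a polynomial in the coordinate functions. -/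
noncomputable def fn : K[X][X] →+* W.FunctionField :=
  (algebraMap W.CoordinateRing W.FunctionField).comp (CoordinateRing.mk W)

variable {W}

theorem fn_apply (p : K[X][X]) :
    fn W p = algebraMap W.CoordinateRing W.FunctionField (CoordinateRing.mk W p) := rfl

theorem fn_CC (c : K) : fn W (C (C c)) = algebraMap K W.FunctionField c := by
  rw [IsScalarTower.algebraMap_apply K W.CoordinateRing W.FunctionField]
  rfl

theorem fn_C (p : K[X]) : fn W (C p) = aeval (fn W (C X)) p := by
  induction p using Polynomial.induction_on' with
  | add p q hp hq => rw [C_add, map_add, hp, hq, map_add]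
  | monomial n a =>
    rw [← C_mul_X_pow_eq_monomial, C_mul, C_pow, map_mul, map_pow, fn_CC, map_mul, aeval_C,
      map_pow, aeval_X]

theorem fn_equation :
    fn W X * (fn W X + fn W (C (C W.a₁ * X + C W.a₃))) =
      fn W (C (X ^ 3 + C W.a₂ * X ^ 2 + C W.a₄ * X + C W.a₆)) := by
  rw [← map_add, ← map_mul, fn_apply, fn_apply]
  congr 1
  rw [AdjoinRoot.mk_eq_mk]
  exact ⟨1, by rw [polynomial]; ring⟩

theorem exists_fn_eq (r : W.CoordinateRing) :
    ∃ p q : K[X], p • (1 : W.CoordinateRing) + q • CoordinateRing.mk W X = r ∧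
      algebraMap W.CoordinateRing W.FunctionField r = fn W (C p) + fn W (C q) * fn W X := by
  obtain ⟨p, q, rfl⟩ := CoordinateRing.exists_smul_basis_eq r
  refine ⟨p, q, rfl, ?_⟩
  rw [CoordinateRing.smul, CoordinateRing.smul, mul_one, map_add, map_mul]
  rfl

variable {v : Place K W.FunctionField}

theorem one_lt_valuation_X (hv : fn W (C X) ∉ v.ring) : 1 < v.ring.valuation (fn W (C X)) := by
  rwa [← not_le, v.ring.valuation_le_one_iff]

theorem valuation_fn_C (hv : fn W (C X) ∉ v.ring) {p : K[X]} (hp : p ≠ 0) :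
    v.ring.valuation (fn W (C p)) = v.ring.valuation (fn W (C X)) ^ p.natDegree := by
  have : v.ring.valuation.IsTrivialOn K := ⟨fun a ha => v.valuation_algebraMap ha⟩
  rw [fn_C]
  exact valuation_aeval_eq_valuation_X_pow_natDegree_of_one_lt_valuation_X _
    (one_lt_valuation_X hv) hp

/-- Compare the sizes of the two sides of `Y (Y + a₁ X + a₃) = X ^ 3 + ⋯`. If `Y` were no larger
than `X`, the left side would be at most of size `X ^ 2`; hence `Y` dominates its factor. -/
theorem valuation_X_lt_Y (hv : fn W (C X) ∉ v.ring) :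
    v.ring.valuation (fn W (C X)) < v.ring.valuation (fn W X) ∧
    v.ring.valuation (fn W X) ^ 2 = v.ring.valuation (fn W (C X)) ^ 3 := by
  have h1 := one_lt_valuation_X hv
  have h0 : 0 < v.ring.valuation (fn W (C X)) := zero_lt_one.trans h1
  have hl : v.ring.valuation (fn W (C (C W.a₁ * X + C W.a₃))) ≤ v.ring.valuation (fn W (C X)) := by
    by_cases hz : C W.a₁ * X + C W.a₃ = 0
    · rw [hz, C_0, map_zero, map_zero]; exact zero_le
    · rw [valuation_fn_C hv hz]
      calc _ ≤ v.ring.valuation (fn W (C X)) ^ 1 := pow_le_pow_right₀ h1.le natDegree_linear_le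
        _ = _ := pow_one _
  have hr : v.ring.valuation (fn W (C (X ^ 3 + C W.a₂ * X ^ 2 + C W.a₄ * X + C W.a₆))) =
      v.ring.valuation (fn W (C X)) ^ 3 := by
    have e : (X ^ 3 + C W.a₂ * X ^ 2 + C W.a₄ * X + C W.a₆ : K[X]) =
      C 1 * X ^ 3 + C W.a₂ * X ^ 2 + C W.a₄ * X + C W.a₆ := by rw [C_1, one_mul]
    have hd := natDegree_cubic (b := W.a₂) (c := W.a₄) (d := W.a₆) (one_ne_zero' K)
    rw [e, valuation_fn_C hv, hd]
    intro hz
    rw [hz, natDegree_zero] at hd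
    omega
  have heq := congrArg v.ring.valuation (fn_equation (W := W))
  rw [map_mul, hr] at heq
  have hlt : v.ring.valuation (fn W (C X)) < v.ring.valuation (fn W X) := by
    by_contra! hle
    have h2 := (v.ring.valuation.map_add (fn W X) (fn W (C (C W.a₁ * X + C W.a₃)))).trans
      (max_le hle hl)
    have h3 := mul_le_mul' hle h2
    rw [heq, ← pow_two] at h3
    exact absurd h3 (not_le.mpr (pow_lt_pow_right₀ h1 (by norm_num)))
  refine ⟨hlt, ?_⟩
  rw [v.ring.valuation.map_add_eq_of_lt_left (hl.trans_lt hlt), ← pow_two] at heq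
  exact heq

/-- The valuation of `X / Y`, a uniformizer at infinity. -/
theorem valuation_X_Y_eq (hv : fn W (C X) ∉ v.ring) {s : v.ring.ValueGroup}
    (hs : s = v.ring.valuation (fn W (C X) / fn W X)) :
    0 < s ∧ s < 1 ∧ v.ring.valuation (fn W (C X)) = s ^ (-2 : ℤ) ∧
      v.ring.valuation (fn W X) = s ^ (-3 : ℤ) := by
  obtain ⟨h1, h2⟩ := valuation_X_lt_Y hv
  have h0 : 0 < v.ring.valuation (fn W (C X)) := zero_lt_one.trans (one_lt_valuation_X hv)
  have h0' := h0.trans h1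
  rw [map_div₀] at hs
  generalize v.ring.valuation (fn W (C X)) = a at *
  generalize v.ring.valuation (fn W X) = b at *
  have ha := h0.ne'
  have hb := h0'.ne'
  refine ⟨hs ▸ div_pos h0 h0', hs ▸ (div_lt_one₀ h0').mpr h1, ?_, ?_⟩
  · rw [hs, zpow_neg, zpow_ofNat, div_pow, inv_div, h2, pow_succ,
      mul_div_cancel_left₀ _ (by simp [ha])]
  · rw [hs, zpow_neg, zpow_ofNat, div_pow, inv_div, ← h2, pow_succ,
      mul_div_cancel_left₀ _ (by simp [hb])]

/-- For `r = p + q Y` the two summands have pole orders `2 deg p` and `2 deg q + 3`. Their parities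
differ, so nothing cancels and the larger one survives; the degree of the norm is the same maximum.
-/
theorem valuation_algebraMap_eq (hv : fn W (C X) ∉ v.ring) {r : W.CoordinateRing} (hr : r ≠ 0) :
    v.ring.valuation (algebraMap _ W.FunctionField r) =
      v.ring.valuation (fn W (C X) / fn W X) ^ (-(Algebra.norm K[X] r).natDegree : ℤ) := by
  obtain ⟨s, hs⟩ : ∃ s, s = v.ring.valuation (fn W (C X) / fn W X) := ⟨_, rfl⟩
  obtain ⟨s0, s1, hX, hY⟩ := valuation_X_Y_eq hv hs
  rw [← hs]
  obtain ⟨p, q, rfl, e⟩ := exists_fn_eq r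
  have hn := CoordinateRing.degree_norm_smul_basis (W' := W) p q
  rw [e]
  have hC : ∀ {p : K[X]}, p ≠ 0 → v.ring.valuation (fn W (C p)) = s ^ (-(2 * p.natDegree) : ℤ) := by
    intro p hp
    rw [valuation_fn_C hv hp, hX, ← zpow_natCast, ← zpow_mul]
    congr 1
  have hCY : ∀ {q : K[X]}, q ≠ 0 → v.ring.valuation (fn W (C q) * fn W X) =
      s ^ (-(2 * q.natDegree + 3) : ℤ) := by
    intro q hq
    rw [map_mul, hC hq, hY, ← zpow_add₀ s0.ne']
    congr 1; ring
  by_cases hp : p = 0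
  · have hq : q ≠ 0 := by rintro rfl; simp [hp] at hr
    have hd : (Algebra.norm K[X] (p • 1 + q • CoordinateRing.mk W X)).natDegree =
        2 * q.natDegree + 3 := by
      apply natDegree_eq_of_degree_eq_some
      rw [hn, hp, degree_zero, degree_eq_natDegree hq]
      rfl
    rw [hd, hp, C_0, map_zero, zero_add, hCY hq]
    push_cast; rfl
  by_cases hq : q = 0
  · have hd : (Algebra.norm K[X] (p • 1 + q • CoordinateRing.mk W X)).natDegree =
        2 * p.natDegree := by
      apply natDegree_eq_of_degree_eq_some
      rw [hn, hq, degree_zero, degree_eq_natDegree hp]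
      rfl
    rw [hd, hq, C_0, map_zero, zero_mul, add_zero, hC hp]
    push_cast; rfl
  have hd : (Algebra.norm K[X] (p • 1 + q • CoordinateRing.mk W X)).natDegree =
      max (2 * p.natDegree) (2 * q.natDegree + 3) := by
    apply natDegree_eq_of_degree_eq_some
    rw [hn, degree_eq_natDegree hp, degree_eq_natDegree hq]
    rfl
  have hne : v.ring.valuation (fn W (C p)) ≠ v.ring.valuation (fn W (C q) * fn W X) := by
    rw [hC hp, hCY hq]
    intro h
    have := (zpow_right_strictAnti₀ s0 s1).injective h
    omega
  rw [v.ring.valuation.map_add_of_distinct_val hne, hC hp, hCY hq, hd]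
  rcases le_total (2 * p.natDegree) (2 * q.natDegree + 3) with h | h
  · rw [max_eq_right h, max_eq_right ((zpow_right_strictAnti₀ s0 s1).le_iff_ge.mpr (by omega))]
    push_cast; rfl
  · rw [max_eq_left h, max_eq_left ((zpow_right_strictAnti₀ s0 s1).le_iff_ge.mpr (by omega))]
    push_cast; rfl

/-- The valuation of every non-zero function is an integral power of that of `X / Y`. -/
theorem isUniformizer_X_div_Y (hv : fn W (C X) ∉ v.ring) :
    v.IsUniformizer (fn W (C X) / fn W X) := by
  obtain ⟨s, hs⟩ : ∃ s, s = v.ring.valuation (fn W (C X) / fn W X) := ⟨_, rfl⟩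
  obtain ⟨s0, s1, hX, hY⟩ := valuation_X_Y_eq hv hs
  refine ⟨hs ▸ s1, fun h hh => ?_⟩
  by_cases h0 : h = 0
  · rw [h0, map_zero]; exact zero_le
  obtain ⟨a, b, hb, rfl⟩ := IsFractionRing.div_surjective (A := W.CoordinateRing) h
  have ha : a ≠ 0 := by rintro rfl; simp at h0
  rw [map_div₀, valuation_algebraMap_eq hv ha,
    valuation_algebraMap_eq hv (nonZeroDivisors.ne_zero hb), ← hs, ← zpow_sub₀ s0.ne'] at hh ⊢
  rw [zpow_lt_one_iff_right_of_lt_one₀ s0 s1] at hh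
  nth_rw 2 [← zpow_one s]
  exact (zpow_le_zpow_iff_right_of_lt_one₀ s0 s1).mpr hh

variable (W) in
/-- There is a place at infinity. -/
theorem exists_place_infinity : ∃ v : Place K W.FunctionField, fn W (C X) ∉ v.ring := by
  have hx0 : fn W (C X) ≠ 0 := by
    have := CoordinateRing.XClass_ne_zero (W' := W) (0 : K)
    rw [fn_apply, Ne, map_eq_zero_iff _ (IsFractionRing.injective W.CoordinateRing _)]
    simpa [CoordinateRing.XClass] using this
  have htr : ∀ p : K[X], aeval (fn W (C X)) p = 0 → p = 0 := by
    intro p hp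
    rw [← fn_C, fn_apply, map_eq_zero_iff _ (IsFractionRing.injective W.CoordinateRing _)] at hp
    exact (map_eq_zero_iff _ (FaithfulSMul.algebraMap_injective K[X] W.CoordinateRing)).mp hp
  let A := Algebra.adjoin K {(fn W (C X))⁻¹}
  let t : A.toSubring := ⟨(fn W (C X))⁻¹, Algebra.subset_adjoin rfl⟩
  -- If `1 / X` were a unit of `K[1 / X]`, then `X` would be a polynomial in `1 / X`, contrary to
  -- its transcendence over `K`.
  have hne : Ideal.span {t} ≠ ⊤ := by
    intro h
    rw [Ideal.eq_top_iff_one, Ideal.mem_span_singleton] at h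
    obtain ⟨⟨c, hc⟩, e⟩ := h
    have e' : 1 = (fn W (C X))⁻¹ * c := congrArg Subtype.val e
    have hc' : c = fn W (C X) := by field_simp at e'; exact e'.symm
    have hmem : c ∈ Algebra.adjoin K {(fn W (C X))⁻¹} := hc
    rw [Algebra.adjoin_singleton_eq_range_aeval] at hmem
    obtain ⟨p, hp⟩ := hmem
    have hp' : aeval (fn W (C X))⁻¹ p = fn W (C X) := hp.trans hc'
    have halg : IsAlgebraic K (fn W (C X))⁻¹ := by
      refine ⟨X * p - 1, fun h => ?_, ?_⟩
      · simpa using congrArg (coeff · 0) h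
      · rw [map_sub, map_mul, aeval_X, hp', map_one, inv_mul_cancel₀ hx0, sub_self]
    obtain ⟨q, hq, hq'⟩ := IsAlgebraic.inv_iff.mp halg
    exact hq (htr q hq')
  obtain ⟨B, hB, hI⟩ := Ideal.image_subset_nonunits_valuationSubring _ hne
  have hlt : B.valuation (fn W (C X))⁻¹ < 1 := hI ⟨t, Ideal.mem_span_singleton_self t, rfl⟩
  have hnot : fn W (C X) ∉ B := by
    rw [← B.valuation_le_one_iff, not_le]
    rw [map_inv₀] at hlt
    exact (inv_lt_one₀ ((Valuation.pos_iff _).mpr hx0)).mp hlt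
  refine ⟨⟨B, fun c => hB (A.algebraMap_mem c), ?_⟩, hnot⟩
  rintro rfl
  exact hnot trivial

end Infinity

/-! ### Functions with simple poles at rational points -/

section RiemannRoch

open WeierstrassCurve WeierstrassCurve.Affine

variable {K : Type*} [Field K] {W : WeierstrassCurve.Affine K}

theorem Place.IsCenter.exists_isUniformizer_of_isDedekindDomain {F R : Type*} [Field F]
    [Algebra K F] [CommRing R] [IsDedekindDomain R] [Algebra R F] [IsFractionRing R F]
    {v : Place K F} {m : Ideal R} [m.IsPrime] (hm : m ≠ ⊥) (hc : v.IsCenter m) :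
    ∃ t, v.IsUniformizer t := by
  have := IsLocalization.AtPrime.isDiscreteValuationRing_of_dedekind_domain R hm
    (Localization.AtPrime m)
  exact hc.exists_isUniformizer inferInstance

/-- An integrally closed domain is the intersection of the valuation rings of its fraction field
that contain it. -/
theorem exists_algebraMap_eq_of_forall_place {F R : Type*} [Field F]
    [Algebra K F] [CommRing R] [IsDomain R] [IsIntegrallyClosed R] [Algebra R F]
    [IsFractionRing R F] [Algebra K R] [IsScalarTower K R F] {f : F}
    (hf : ∀ v : Place K F, (∀ r : R, algebraMap R F r ∈ v.ring) → f ∈ v.ring) :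
    ∃ r : R, algebraMap R F r = f := by
  have hinj : Function.Injective (algebraMap R F) := IsFractionRing.injective R F
  let e : R ≃+* (algebraMap R F).range := RingEquiv.ofBijective (algebraMap R F).rangeRestrict
    ⟨fun a b h => hinj (congrArg Subtype.val h), (algebraMap R F).rangeRestrict_surjective⟩
  have hcl : IsIntegrallyClosedIn (algebraMap R F).range F := by
    rw [Subring.isIntegrallyClosedIn_iff]
    intro x hx
    refine (isIntegrallyClosed_iff F).mp (inferInstance : IsIntegrallyClosed R) ?_
    refine IsIntegral.map_of_comp_eq (e.symm : (algebraMap R F).range →+* R) (RingHom.id F)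
      (RingHom.ext fun r => ?_) hx
    exact congrArg Subtype.val (e.apply_symm_apply r)
  by_contra hne
  obtain ⟨V, hV, hfV⟩ := Subring.exists_le_valuationSubring_of_isIntegrallyClosedIn
    (R := (algebraMap R F).range) (x := f) hne
  have hR : ∀ r : R, algebraMap R F r ∈ V := fun r => hV ⟨r, rfl⟩
  refine hfV (hf ⟨V, fun c => ?_, ?_⟩ hR)
  · rw [IsScalarTower.algebraMap_apply K R F]; exact hR _
  · rintro rfl; exact hfV trivial

variable (W) in
/-- The ideal of functions vanishing at a point; the unit ideal for the point at infinity. -/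
noncomputable def pointIdeal : W.Point → Ideal W.CoordinateRing
  | .zero => ⊤
  | .some x y _ => CoordinateRing.XYIdeal W x (C y)

variable (W) in
/-- A rational function whose divisor of poles is `(Q) + (0)`, for a point `Q ≠ 0`. -/
noncomputable def poleFn : W.Point → W.FunctionField
  | .zero => 1
  | .some x y _ => fn W (X - C (C (W.negY x y))) / fn W (C (X - C x))

theorem poleFn_zero : poleFn W 0 = 1 := rfl

theorem pointIdeal_isMaximal {Q : W.Point} (hQ : Q ≠ 0) : (pointIdeal W Q).IsMaximal := by
  cases Q with
  | zero => exact absurd rfl hQ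
  | some x y h => exact XYIdeal_isMaximal h.1

theorem pointIdeal_ne_bot (Q : W.Point) : pointIdeal W Q ≠ ⊥ := by
  cases Q with
  | zero => exact top_ne_bot
  | some x y h => exact XYIdeal_ne_bot x y

theorem mk_mem_pointIdeal_some {x y : K} (h : W.Nonsingular x y) (p : K[X][X]) :
    CoordinateRing.mk W p ∈ pointIdeal W (.some x y h) ↔ p.evalEval x y = 0 :=
  mk_mem_XYIdeal_iff h.1 p

theorem pointIdeal_injOn {P Q : W.Point} (hP : P ≠ 0) (hQ : Q ≠ 0)
    (h : pointIdeal W P = pointIdeal W Q) : P = Q := by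
  cases P with
  | zero => exact absurd rfl hP
  | some x y h1 =>
  cases Q with
  | zero => exact absurd rfl hQ
  | some x' y' h2 =>
    have hx : CoordinateRing.mk W (C (X - C x)) ∈ pointIdeal W (.some x' y' h2) := by
      rw [← h, mk_mem_pointIdeal_some]; simp [evalEval]
    have hy : CoordinateRing.mk W (X - C (C y)) ∈ pointIdeal W (.some x' y' h2) := by
      rw [← h, mk_mem_pointIdeal_some]; simp [evalEval]
    rw [mk_mem_pointIdeal_some] at hx hy
    simp only [eval_sub, eval_X, eval_C, evalEval, sub_eq_zero] at hx hy
    subst hx hy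
    rfl

theorem isPrincipalIdealRing_localization_pointIdeal {Q : W.Point}
    [h : (pointIdeal W Q).IsPrime] :
    IsPrincipalIdealRing (Localization.AtPrime (pointIdeal W Q)) := by
  cases Q with
  | zero => exact absurd rfl h.ne_top
  | some x y hn =>
    have : (CoordinateRing.XYIdeal W x (C y)).IsPrime := h
    exact isPrincipalIdealRing_localization_XYIdeal hn

variable {v : Place K W.FunctionField}

theorem Place.IsCenter.ne_zero {Q : W.Point} (hc : v.IsCenter (pointIdeal W Q)) : Q ≠ 0 := by
  rintro rfl
  have := (hc 1).2.mpr trivial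
  rw [map_one, map_one] at this
  exact lt_irrefl _ this

theorem valuationRing_localization_pointIdeal (Q : W.Point) [(pointIdeal W Q).IsPrime] :
    ValuationRing (Localization.AtPrime (pointIdeal W Q)) :=
  have := isPrincipalIdealRing_localization_pointIdeal (Q := Q)
  inferInstance

theorem exists_sub_algebraMap_mem (Q : W.Point) (a : W.CoordinateRing) :
    ∃ c : K, a - algebraMap K _ c ∈ pointIdeal W Q := by
  cases Q with
  | zero => exact ⟨0, trivial⟩
  | some x y h =>
    obtain ⟨p, rfl⟩ := AdjoinRoot.mk_surjective a
    refine ⟨p.evalEval x y, ?_⟩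
    have : CoordinateRing.mk W (p - C (C (p.evalEval x y))) ∈ pointIdeal W (.some x y h) := by
      rw [mk_mem_pointIdeal_some, evalEval_sub, evalEval_C, eval_C, sub_self]
    rwa [map_sub] at this

/-- A function that is regular at a rational point has a value there. -/
theorem Place.IsCenter.exists_value {Q : W.Point} (hc : v.IsCenter (pointIdeal W Q))
    {f : W.FunctionField} (hf : v.ring.valuation f ≤ 1) :
    ∃ c : K, ∀ w : Place K W.FunctionField, w.IsCenter (pointIdeal W Q) →
      w.ring.valuation (f - algebraMap K _ c) < 1 := by
  have := (pointIdeal_isMaximal hc.ne_zero).isPrime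
  have := valuationRing_localization_pointIdeal Q
  obtain ⟨a, b, hb, e⟩ := hc.exists_mul_eq hf
  obtain ⟨c, hcb⟩ := (pointIdeal_isMaximal hc.ne_zero).exists_inv hb
  obtain ⟨i, hi, e1⟩ := hcb
  -- Here `c` inverts `b` modulo the ideal of `Q`, so `d` is the value of `a / b`. It depends only
  -- on `a`, `b` and `Q`, hence serves every place centered at `Q`.
  obtain ⟨d, hd⟩ := exists_sub_algebraMap_mem Q (c * a)
  refine ⟨d, fun w hw => ?_⟩
  have hmem : a - algebraMap K _ d * b ∈ pointIdeal W Q := by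
    have h1 : a - algebraMap K _ d * b = b * (c * a - algebraMap K _ d) + i * a := by
      linear_combination (-a) * e1
    rw [h1]
    exact add_mem (Ideal.mul_mem_left _ _ hd) (Ideal.mul_mem_right _ _ hi)
  have h2 := (hw _).2.mpr hmem
  have h3 : (f - algebraMap K _ d) * algebraMap _ W.FunctionField b =
      algebraMap _ W.FunctionField (a - algebraMap K _ d * b) := by
    rw [sub_mul, e, map_sub, map_mul, ← IsScalarTower.algebraMap_apply]
  rw [← h3, map_mul, hw.valuation_eq_one hb, mul_one] at h2
  exact h2

theorem fn_X_sub_ne_zero (x : K) : fn W (C (X - C x)) ≠ 0 := by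
  rw [fn_apply, Ne, map_eq_zero_iff _ (IsFractionRing.injective W.CoordinateRing _)]
  exact CoordinateRing.XClass_ne_zero x

theorem fn_Y_sub_ne_zero (y : K) : fn W (X - C (C y)) ≠ 0 := by
  rw [fn_apply, Ne, map_eq_zero_iff _ (IsFractionRing.injective W.CoordinateRing _)]
  exact CoordinateRing.YClass_ne_zero (C y)

theorem fn_sub_mul_sub {x y : K} (h : W.Equation x y) :
    fn W (X - C (C y)) * fn W (X - C (C (W.negY x y))) =
      fn W (C (X - C x)) * fn W (cofactor W x) := by
  rw [fn_apply, fn_apply, ← map_mul, mk_sub_mul_sub h, map_mul]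
  rfl

theorem poleFn_ne_zero (Q : W.Point) : poleFn W Q ≠ 0 := by
  cases Q with
  | zero => exact one_ne_zero
  | some x y h => exact div_ne_zero (fn_Y_sub_ne_zero _) (fn_X_sub_ne_zero _)

/-- The second expression shows that `poleFn Q` is regular where `X - x` vanishes but `Y - y` does
not, namely at `-Q` if `-Q ≠ Q`. It also gives the pole order at `Q` when `Q = -Q`. -/
theorem poleFn_some_eq {x y : K} (h : W.Nonsingular x y) :
    poleFn W (.some x y h) = fn W (cofactor W x) / fn W (X - C (C y)) := by
  rw [poleFn, div_eq_div_iff (fn_X_sub_ne_zero _) (fn_Y_sub_ne_zero _), mul_comm,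
    fn_sub_mul_sub h.1, mul_comm]

/-- `1 / poleFn Q` is a uniformizer at `Q`. -/
theorem Place.IsCenter.isUniformizer_poleFn {Q : W.Point} (hc : v.IsCenter (pointIdeal W Q)) :
    v.IsUniformizer (poleFn W Q)⁻¹ := by
  have := (pointIdeal_isMaximal hc.ne_zero).isPrime
  have := valuationRing_localization_pointIdeal Q
  cases Q with
  | zero => exact absurd rfl hc.ne_zero
  | some x y h =>
    have hle : ∀ p, v.ring.valuation (fn W p) ≤ 1 := fun p =>
      (v.ring.valuation_le_one_iff _).mpr (hc _).1
    have hX : v.ring.valuation (fn W (C (X - C x))) < 1 := by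
      rw [fn_apply, (hc _).2, mk_mem_pointIdeal_some]; simp [evalEval]
    have hY : v.ring.valuation (fn W (X - C (C y))) < 1 := by
      rw [fn_apply, (hc _).2, mk_mem_pointIdeal_some]; simp [evalEval]
    have hX' : v.ring.valuation (fn W (C (X - C x))) ≤
        v.ring.valuation (poleFn W (.some x y h))⁻¹ := by
      have : fn W (C (X - C x)) = (poleFn W (.some x y h))⁻¹ * fn W (X - C (C (W.negY x y))) := by
        rw [poleFn, inv_div, div_mul_cancel₀ _ (fn_Y_sub_ne_zero _)]
      nth_rw 1 [this]
      rw [map_mul]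
      exact mul_le_of_le_one_right' (hle _)
    have hY' : v.ring.valuation (fn W (X - C (C y))) ≤
        v.ring.valuation (poleFn W (.some x y h))⁻¹ := by
      have : fn W (X - C (C y)) = (poleFn W (.some x y h))⁻¹ * fn W (cofactor W x) := by
        have h0 := poleFn_ne_zero (.some x y h)
        rw [eq_inv_mul_iff_mul_eq₀ h0, poleFn_some_eq, div_mul_cancel₀ _ (fn_Y_sub_ne_zero _)]
      nth_rw 1 [this]
      rw [map_mul]
      exact mul_le_of_le_one_right' (hle _)
    refine hc.isUniformizer ?_ fun a ha => ?_
    · rcases cofactor_ne_zero_or h with h1 | h1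
      · have : v.ring.valuation (fn W (cofactor W x)) = 1 := by
          rw [fn_apply]
          exact hc.valuation_eq_one (by rwa [mk_mem_pointIdeal_some])
        rwa [poleFn_some_eq, inv_div, map_div₀, this, div_one]
      · have : v.ring.valuation (fn W (X - C (C (W.negY x y)))) = 1 := by
          rw [fn_apply]
          exact hc.valuation_eq_one
            (by rw [mk_mem_pointIdeal_some]; simpa [evalEval, sub_eq_zero] using h1)
        rwa [poleFn, inv_div, map_div₀, this, div_one]
    · obtain ⟨b, c, rfl⟩ := exists_mk_mul_of_mem_XYIdeal ha
      rw [map_add, map_mul, map_mul]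
      refine (v.ring.valuation.map_add _ _).trans (max_le ?_ ?_)
      · rw [map_mul]
        exact (mul_le_of_le_one_left' ((v.ring.valuation_le_one_iff _).mpr (hc b).1)).trans hX'
      · rw [map_mul]
        exact (mul_le_of_le_one_left' ((v.ring.valuation_le_one_iff _).mpr (hc c).1)).trans hY'

theorem Place.IsCenter.one_lt_poleFn {Q : W.Point} (hc : v.IsCenter (pointIdeal W Q)) :
    1 < v.ring.valuation (poleFn W Q) := by
  have h := hc.isUniformizer_poleFn.1
  rw [map_inv₀] at h
  exact (inv_lt_one₀ ((Valuation.pos_iff _).mpr (poleFn_ne_zero Q))).mp h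

/-- `poleFn Q` is regular at all affine places other than `Q`. -/
theorem Place.IsCenter.poleFn_le_one {Q : W.Point} {m : Ideal W.CoordinateRing}
    (hc : v.IsCenter m) (hm : m ≠ pointIdeal W Q) :
    v.ring.valuation (poleFn W Q) ≤ 1 := by
  cases Q with
  | zero => exact (map_one _).le
  | some x y h =>
    have hle : ∀ p, v.ring.valuation (fn W p) ≤ 1 := fun p =>
      (v.ring.valuation_le_one_iff _).mpr (hc _).1
    have hmtop : m ≠ ⊤ := by
      rintro rfl
      have := (hc 1).2.mpr trivial
      rw [map_one, map_one] at this
      exact lt_irrefl _ this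
    by_cases hX : CoordinateRing.mk W (C (X - C x)) ∈ m
    · by_cases hY : CoordinateRing.mk W (X - C (C y)) ∈ m
      · refine absurd ?_ hm
        refine ((XYIdeal_isMaximal h.1).eq_of_le hmtop ?_).symm
        rw [CoordinateRing.XYIdeal, Ideal.span_le, Set.pair_subset_iff]
        exact ⟨hX, hY⟩
      · rw [poleFn_some_eq, map_div₀, fn_apply (X - C (C y)), hc.valuation_eq_one hY, div_one]
        exact hle _
    · rw [poleFn, map_div₀, fn_apply (C (X - C x)), hc.valuation_eq_one hX, div_one]
      exact hle _

theorem valuation_poleFn_infinity (hv : fn W (C X) ∉ v.ring) {Q : W.Point} (hQ : Q ≠ 0) :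
    v.ring.valuation (poleFn W Q) = (v.ring.valuation (fn W (C X) / fn W X))⁻¹ := by
  cases Q with
  | zero => exact absurd rfl hQ
  | some x y h =>
    obtain ⟨h1, -⟩ := valuation_X_lt_Y hv
    have hconst : ∀ c : K, v.ring.valuation (fn W (C (C c))) ≤ 1 := by
      intro c
      rw [fn_CC]
      exact (v.ring.valuation_le_one_iff _).mpr (v.const_mem c)
    rw [poleFn, map_div₀, map_div₀, inv_div, C_sub, (fn W).map_sub, (fn W).map_sub,
      v.ring.valuation.map_sub_eq_of_lt_left ((hconst _).trans_lt (one_lt_valuation_X hv)),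
      v.ring.valuation.map_sub_eq_of_lt_left
        ((hconst _).trans_lt ((one_lt_valuation_X hv).trans h1))]

theorem exists_isCenter_pointIdeal {Q : W.Point} (hQ : Q ≠ 0) :
    ∃ v : Place K W.FunctionField, v.IsCenter (pointIdeal W Q) :=
  have := pointIdeal_isMaximal hQ
  Place.exists_isCenter (pointIdeal W Q) (pointIdeal_ne_bot Q)

/-- At a place centered at `Q` the function of index `Q` has a pole and all the others are regular,
so its coefficient in a relation vanishes. Subtracting constants does not affect this. -/
theorem linearIndependent_poleFn_sub (c : W.Point → K) :
    LinearIndependent K (fun Q : {Q : W.Point // Q ≠ 0} => poleFn W Q - algebraMap K _ (c Q)) := by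
  rw [linearIndependent_iff']
  intro s g hg Q hQs
  by_contra hgQ
  obtain ⟨v, hv⟩ := exists_isCenter_pointIdeal Q.2
  have hsmall : ∀ a : K, v.ring.valuation (algebraMap K W.FunctionField a) ≤ 1 := fun a =>
    (v.ring.valuation_le_one_iff _).mpr (v.const_mem a)
  have hbig : 1 < v.ring.valuation (g Q • (poleFn W Q - algebraMap K _ (c Q))) := by
    rw [Algebra.smul_def, map_mul, v.valuation_algebraMap hgQ, one_mul,
      v.ring.valuation.map_sub_eq_of_lt_left ((hsmall _).trans_lt hv.one_lt_poleFn)]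
    exact hv.one_lt_poleFn
  classical
  rw [← Finset.add_sum_erase _ _ hQs] at hg
  have hle : v.ring.valuation (∑ R ∈ s.erase Q, g R • (poleFn W R - algebraMap K _ (c R))) ≤ 1 := by
    refine v.ring.valuation.map_sum_le fun R hR => ?_
    rw [Algebra.smul_def, map_mul]
    refine (mul_le_of_le_one_left' (hsmall _)).trans ?_
    refine (v.ring.valuation.map_sub _ _).trans (max_le (hv.poleFn_le_one ?_) (hsmall _))
    intro h
    exact (Finset.ne_of_mem_erase hR) (Subtype.ext (pointIdeal_injOn Q.2 R.2 h)).symm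
  rw [eq_neg_of_add_eq_zero_left hg, Valuation.map_neg] at hbig
  exact absurd hbig (not_lt.mpr hle)

theorem exists_eq_algebraMap_of_natDegree_norm_eq_zero {r : W.CoordinateRing}
    (h : (Algebra.norm K[X] r).natDegree = 0) : ∃ c : K, r = algebraMap K _ c := by
  obtain ⟨p, q, rfl⟩ := CoordinateRing.exists_smul_basis_eq r
  have h4 := (CoordinateRing.degree_norm_smul_basis (W' := W) p q).symm.trans_le
    (degree_le_of_natDegree_le h.le)
  have hq : q = 0 := by
    by_contra hq
    have := (le_max_right _ _).trans h4
    rw [degree_eq_natDegree hq] at this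
    have h5 : ((2 * q.natDegree + 3 : ℕ) : WithBot ℕ) ≤ ((0 : ℕ) : WithBot ℕ) := this
    have h6 := WithBot.coe_le_coe.mp h5
    simp at h6
  have hp : p.natDegree = 0 := by
    by_contra hp
    have hp0 : p ≠ 0 := by rintro rfl; simp at hp
    have := (le_max_left _ _).trans h4
    rw [degree_eq_natDegree hp0] at this
    have h5 : ((2 * p.natDegree : ℕ) : WithBot ℕ) ≤ ((0 : ℕ) : WithBot ℕ) := this
    have h6 : 2 * p.natDegree ≤ 0 := WithBot.coe_le_coe.mp h5
    omega
  rw [natDegree_eq_zero] at hp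
  obtain ⟨c, rfl⟩ := hp
  refine ⟨c, ?_⟩
  rw [hq, zero_smul, add_zero, CoordinateRing.smul, mul_one]
  rfl

/-- Regularity at all affine places puts `f` in the coordinate ring. Its pole order at infinity is
the degree of its norm, which is never one; being at most one it is zero, and `f` is constant. -/
theorem exists_eq_algebraMap_of_regular [W.IsElliptic] {f : W.FunctionField}
    (hinf : ∀ v : Place K W.FunctionField, fn W (C X) ∉ v.ring →
      v.ring.valuation f ≤ (v.ring.valuation (fn W (C X) / fn W X))⁻¹)
    (haff : ∀ v : Place K W.FunctionField, ∀ m : Ideal W.CoordinateRing, v.IsCenter m →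
      v.ring.valuation f ≤ 1) : ∃ c : K, f = algebraMap K _ c := by
  obtain ⟨r, rfl⟩ := exists_algebraMap_eq_of_forall_place (K := K) (R := W.CoordinateRing)
    (f := f) fun v hv => by
      obtain ⟨m, -, -, hc⟩ := v.exists_center hv
      exact (v.ring.valuation_le_one_iff _).mp (haff v m hc)
  by_cases hr : r = 0
  · exact ⟨0, by rw [hr, map_zero, map_zero]⟩
  obtain ⟨v, hv⟩ := exists_place_infinity W
  have h1 := hinf v hv
  obtain ⟨s, hs⟩ : ∃ s, s = v.ring.valuation (fn W (C X) / fn W X) := ⟨_, rfl⟩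
  obtain ⟨s0, s1, -, -⟩ := valuation_X_Y_eq hv hs
  rw [valuation_algebraMap_eq hv hr, ← hs, ← zpow_neg_one,
    zpow_le_zpow_iff_right_of_lt_one₀ s0 s1] at h1
  have h2 := CoordinateRing.natDegree_norm_ne_one r
  have h3 : (Algebra.norm K[X] r).natDegree = 0 := by omega
  obtain ⟨c, rfl⟩ := exists_eq_algebraMap_of_natDegree_norm_eq_zero h3
  exact ⟨c, (IsScalarTower.algebraMap_apply K W.CoordinateRing W.FunctionField c).symm⟩

/-- The upper bound in the Riemann-Roch theorem, for reduced divisors of rational points. -/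
theorem mem_span_poleFn [W.IsElliptic] (T : Finset W.Point) {f : W.FunctionField}
    (hinf : ∀ v : Place K W.FunctionField, fn W (C X) ∉ v.ring →
      v.ring.valuation f ≤ (v.ring.valuation (fn W (C X) / fn W X))⁻¹)
    (haff : ∀ v : Place K W.FunctionField, ∀ m : Ideal W.CoordinateRing, v.IsCenter m →
      (∀ Q ∈ T, m ≠ pointIdeal W Q) → v.ring.valuation f ≤ 1)
    (hT : ∀ v : Place K W.FunctionField, ∀ Q ∈ T, v.IsCenter (pointIdeal W Q) →
      v.ring.valuation f ≤ v.ring.valuation (poleFn W Q)) :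
    ∃ (c : K) (a : W.Point → K), f = algebraMap K _ c + ∑ Q ∈ T, a Q • poleFn W Q := by
  classical
  induction T using Finset.induction_on generalizing f with
  | empty =>
    obtain ⟨c, hc⟩ := exists_eq_algebraMap_of_regular hinf fun v m hm => haff v m hm (by simp)
    exact ⟨c, 0, by simpa using hc⟩
  | insert Q T hQT ih =>
    -- The scalar `a` is the value at `Q` of `f / poleFn W Q`, the leading coefficient of the pole.
    -- After subtraction the pole order is less than one.
    obtain ⟨a, ha⟩ : ∃ a : K, ∀ v : Place K W.FunctionField, v.IsCenter (pointIdeal W Q) →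
        v.ring.valuation (f - a • poleFn W Q) ≤ 1 := by
      by_cases hQ : Q = 0
      · exact ⟨0, fun v hv => absurd hQ hv.ne_zero⟩
      obtain ⟨v, hv⟩ := exists_isCenter_pointIdeal hQ
      have h1 : v.ring.valuation (f / poleFn W Q) ≤ 1 := by
        rw [map_div₀]
        exact div_le_one_of_le₀ (hT v Q (Finset.mem_insert_self _ _) hv) zero_le
      obtain ⟨a, ha⟩ := hv.exists_value h1
      refine ⟨a, fun w hw => hw.isUniformizer_poleFn.one_le_of_lt ?_⟩
      have h2 : f - a • poleFn W Q = (f / poleFn W Q - algebraMap K _ a) * poleFn W Q := by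
        rw [sub_mul, div_mul_cancel₀ _ (poleFn_ne_zero Q), Algebra.smul_def]
      rw [h2, map_mul, map_inv₀, inv_inv]
      exact mul_lt_of_lt_one_left ((Valuation.pos_iff _).mpr (poleFn_ne_zero Q)) (ha w hw)
    have hsub : ∀ v : Place K W.FunctionField, ∀ b, v.ring.valuation f ≤ b →
        v.ring.valuation (poleFn W Q) ≤ b → v.ring.valuation (f - a • poleFn W Q) ≤ b := by
      intro v b hf hb
      refine (v.ring.valuation.map_sub _ _).trans (max_le hf ?_)
      rw [Algebra.smul_def, map_mul]
      exact (mul_le_of_le_one_left' ((v.ring.valuation_le_one_iff _).mpr (v.const_mem a))).trans hb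
    obtain ⟨c, b, hcb⟩ : ∃ (c : K) (b : W.Point → K),
        f - a • poleFn W Q = algebraMap K _ c + ∑ Q ∈ T, b Q • poleFn W Q := by
      refine ih ?_ ?_ ?_
      · intro v hv
        refine hsub v _ (hinf v hv) ?_
        by_cases hQ : Q = 0
        · rw [hQ, poleFn_zero, map_one, ← map_inv₀]
          have := isUniformizer_X_div_Y hv
          rw [map_inv₀]
          exact (one_le_inv₀ this.pos).mpr this.1.le
        · exact (valuation_poleFn_infinity hv hQ).le
      · intro v m hm hmT
        by_cases hmQ : m = pointIdeal W Q
        · subst hmQ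
          exact ha v hm
        · refine hsub v _ (haff v m hm ?_) (hm.poleFn_le_one hmQ)
          intro R hR
          rcases Finset.mem_insert.mp hR with rfl | hR
          · exact hmQ
          · exact hmT R hR
      · intro v R hR hv
        refine hsub v _ (hT v R (Finset.mem_insert_of_mem hR) hv) ?_
        refine (hv.poleFn_le_one ?_).trans hv.one_lt_poleFn.le
        intro h
        by_cases hQ : Q = 0
        · exact hv.ne_zero (by
            by_contra hR0
            exact (pointIdeal_isMaximal hR0).ne_top (by rw [h, hQ]; rfl))
        · exact hQT (pointIdeal_injOn hv.ne_zero hQ h ▸ hR)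
    refine ⟨c, fun R => if R = Q then a else b R, ?_⟩
    simp only
    rw [Finset.sum_insert hQT, if_pos rfl, Finset.sum_congr rfl (g := fun R => b R • poleFn W R)]
    · linear_combination hcb
    · intro R hR
      rw [if_neg]
      rintro rfl
      exact hQT hR

end RiemannRoch

/-! ### Counting zeros, and the sum of the zeros in the group -/

section Zeros

open WeierstrassCurve WeierstrassCurve.Affine nonZeroDivisors

variable {K : Type*} [Field K] {W : WeierstrassCurve.Affine K}

variable (W) in
/-- The invertible fractional ideal of a point. -/
noncomputable def pointUnit : W.Point → (FractionalIdeal W.CoordinateRing⁰ W.FunctionField)ˣ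
  | .zero => 1
  | .some _ _ h => CoordinateRing.XYIdeal' (W := W) h

theorem coe_pointUnit (Q : W.Point) :
    (pointUnit W Q : FractionalIdeal W.CoordinateRing⁰ W.FunctionField) = pointIdeal W Q := by
  cases Q with
  | zero => simp [pointUnit, pointIdeal]
  | some x y h => rfl

theorem toClass_eq_mk_pointUnit [DecidableEq K] (Q : W.Point) :
    Point.toClass Q = Additive.ofMul (ClassGroup.mk W.FunctionField (pointUnit W Q)) := by
  cases Q with
  | zero => exact (congrArg Additive.ofMul (map_one (ClassGroup.mk W.FunctionField))).symm
  | some x y h => rfl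

/-- The map sending a point to the class of its ideal is an injective homomorphism to the class
group, and a principal ideal has trivial class. -/
theorem sum_eq_zero_of_prod_pointIdeal_eq_span [DecidableEq K] {B : Finset W.Point}
    {r : W.CoordinateRing} (hr : r ≠ 0) (h : ∏ Q ∈ B, pointIdeal W Q = Ideal.span {r}) :
    ∑ Q ∈ B, Q = 0 := by
  apply Point.toClass_injective
  rw [map_sum, map_zero]
  simp only [toClass_eq_mk_pointUnit]
  rw [← ofMul_prod, ← map_prod, ← ofMul_one]
  congr 1
  refine (ClassGroup.mk_eq_one_of_coe_ideal (I' := ∏ Q ∈ B, pointIdeal W Q) ?_).mpr ⟨r, hr, h⟩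
  rw [Units.coe_prod, ← FractionalIdeal.coeIdealHom_apply, map_prod]
  exact Finset.prod_congr rfl fun Q _ => coe_pointUnit Q

theorem finrank_quotient_pointIdeal {Q : W.Point} (hQ : Q ≠ 0) :
    finrank K (W.CoordinateRing ⧸ pointIdeal W Q) = 1 := by
  cases Q with
  | zero => exact absurd rfl hQ
  | some x y h =>
    exact (CoordinateRing.quotientXYIdealEquiv (W' := W) (x := x) (y := C y)
      h.1).toLinearEquiv.finrank_eq.trans (finrank_self K)

theorem isCoprime_pointIdeal {P Q : W.Point} (hP : P ≠ 0) (hQ : Q ≠ 0) (h : P ≠ Q) :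
    IsCoprime (pointIdeal W P) (pointIdeal W Q) := by
  have := pointIdeal_isMaximal hP
  have := pointIdeal_isMaximal hQ
  exact Ideal.isCoprime_of_isMaximal fun e => h (pointIdeal_injOn hP hQ e)

/-- By the Chinese remainder theorem, evaluation at `B` maps the quotient by `(r)`, of dimension
`deg N(r)`, onto a space of dimension `|B|`. If the dimensions agree the map is bijective, so `(r)`
is the product of the ideals of the points of `B`. -/
theorem card_le_natDegree_norm [DecidableEq K] {B : Finset W.Point} (hB : 0 ∉ B)
    {r : W.CoordinateRing} (hr : r ≠ 0) (h : ∀ Q ∈ B, r ∈ pointIdeal W Q) :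
    B.card ≤ (Algebra.norm K[X] r).natDegree ∧
      (B.card = (Algebra.norm K[X] r).natDegree → ∑ Q ∈ B, Q = 0) := by
  have hB0 : ∀ Q ∈ B, Q ≠ 0 := fun Q hQ h0 => hB (h0 ▸ hQ)
  have hrank := finrank_quotient_span_eq_natDegree_norm (CoordinateRing.basis W) hr
  -- In degree zero `r` is a non-zero constant without zeros. Treated apart, because finite
  -- dimensionality is deduced below from a positive `finrank`.
  by_cases hd : (Algebra.norm K[X] r).natDegree = 0
  · have hempty : B = ∅ := by
      rw [Finset.eq_empty_iff_forall_notMem]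
      intro Q hQ
      have hu : IsUnit r := by
        obtain ⟨c, rfl⟩ := exists_eq_algebraMap_of_natDegree_norm_eq_zero hd
        exact (isUnit_iff_ne_zero.mpr fun hc => hr (by rw [hc, map_zero])).map _
      exact (pointIdeal_isMaximal (hB0 Q hQ)).ne_top (Ideal.eq_top_of_isUnit_mem _ (h Q hQ) hu)
    rw [hempty]
    exact ⟨Nat.zero_le _, fun _ => rfl⟩
  have : FiniteDimensional K (W.CoordinateRing ⧸ Ideal.span {r}) :=
    Module.finite_of_finrank_pos (by omega)
  let φ : W.CoordinateRing →ₗ[K] (∀ Q : B, W.CoordinateRing ⧸ pointIdeal W (Q : W.Point)) :=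
    LinearMap.pi fun Q => (Ideal.Quotient.mkₐ K (pointIdeal W (Q : W.Point))).toLinearMap
  have hφ : ∀ a, φ a = 0 ↔ ∀ Q ∈ B, a ∈ pointIdeal W Q := by
    intro a
    rw [funext_iff, Subtype.forall]
    exact forall₂_congr fun Q hQ => Ideal.Quotient.eq_zero_iff_mem
  have hsurj : Function.Surjective φ := by
    intro z
    obtain ⟨a, ha⟩ := Ideal.pi_quotient_surjective
      (I := fun Q : B => pointIdeal W (Q : W.Point)) (fun P Q hPQ =>
        isCoprime_pointIdeal (hB0 _ P.2) (hB0 _ Q.2) fun e => hPQ (Subtype.ext e)) z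
    exact ⟨a, funext ha⟩
  have hker : ((Ideal.span {r}).restrictScalars K) ≤ LinearMap.ker φ := by
    intro a ha
    rw [LinearMap.mem_ker, hφ]
    intro Q hQ
    exact (Ideal.span_singleton_le_iff_mem _).mpr (h Q hQ) ha
  let ψ : (W.CoordinateRing ⧸ Ideal.span {r}) →ₗ[K]
      (∀ Q : B, W.CoordinateRing ⧸ pointIdeal W (Q : W.Point)) :=
    ((Ideal.span {r}).restrictScalars K).liftQ φ hker
  have hψ : Function.Surjective ψ := fun z => by
    obtain ⟨a, rfl⟩ := hsurj z
    exact ⟨Ideal.Quotient.mk _ a, rfl⟩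
  have hfd : ∀ Q : B, FiniteDimensional K (W.CoordinateRing ⧸ pointIdeal W (Q : W.Point)) :=
    fun Q => Module.finite_of_finrank_pos
      (by rw [finrank_quotient_pointIdeal (hB0 _ Q.2)]; exact one_pos)
  have hfr : finrank K (∀ Q : B, W.CoordinateRing ⧸ pointIdeal W (Q : W.Point)) = B.card := by
    rw [finrank_pi_fintype, Finset.sum_congr rfl fun Q _ => finrank_quotient_pointIdeal (hB0 _ Q.2)]
    simp
  refine ⟨?_, fun hcard => ?_⟩
  · rw [← hfr, ← hrank]
    exact LinearMap.finrank_le_finrank_of_surjective hψ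
  · refine sum_eq_zero_of_prod_pointIdeal_eq_span hr ?_
    have hinj : Function.Injective ψ :=
      (LinearMap.injective_iff_surjective_of_finrank_eq_finrank (by rw [hfr, hrank, hcard])).mpr hψ
    rw [Ideal.prod_eq_iInf_of_pairwise_isCoprime]
    · refine le_antisymm (fun a ha => ?_) (le_iInf₂ fun Q hQ =>
        (Ideal.span_singleton_le_iff_mem _).mpr (h Q hQ))
      rw [← Ideal.Quotient.eq_zero_iff_mem]
      apply hinj
      rw [map_zero]
      exact (hφ a).mpr (by simpa using ha)
    · intro P hP Q hQ hPQ
      exact isCoprime_pointIdeal (hB0 _ hP) (hB0 _ hQ) hPQ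

theorem poleFn_mul_X_sub {Q : W.Point} {x y : K} {h : W.Nonsingular x y} (hQ : Q = .some x y h) :
    poleFn W Q * fn W (C (X - C x)) = fn W (X - C (C (W.negY x y))) := by
  rw [hQ, poleFn, div_mul_cancel₀ _ (fn_X_sub_ne_zero _)]

variable (W) in
/-- The function `X - x(Q)` of a point `Q ≠ 0`. -/
noncomputable def vertical : W.Point → W.CoordinateRing
  | .zero => 1
  | .some x _ _ => CoordinateRing.mk W (C (X - C x))

theorem vertical_ne_zero (Q : W.Point) : vertical W Q ≠ 0 := by
  cases Q with
  | zero => exact one_ne_zero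
  | some x y h => exact CoordinateRing.XClass_ne_zero x

theorem vertical_mem_neg {Q : W.Point} : Q ≠ 0 → vertical W Q ∈ pointIdeal W (-Q) := by
  cases Q with
  | zero => exact fun h => absurd rfl h
  | some x y h =>
    intro _
    rw [Point.neg_some, vertical, mk_mem_pointIdeal_some]
    simp [evalEval]

theorem exists_poleFn_mul_vertical {Q : W.Point} (hQ : Q ≠ 0) :
    ∃ r ∈ pointIdeal W (-Q), poleFn W Q * algebraMap _ _ (vertical W Q) =
      algebraMap _ W.FunctionField r := by
  cases Q with
  | zero => exact absurd rfl hQ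
  | some x y h =>
    refine ⟨CoordinateRing.mk W (X - C (C (W.negY x y))), ?_, poleFn_mul_X_sub rfl⟩
    rw [Point.neg_some, mk_mem_pointIdeal_some]
    simp [evalEval]

theorem valuation_vertical {v : Place K W.FunctionField} (hv : fn W (C X) ∉ v.ring) {Q : W.Point}
    (hQ : Q ≠ 0) : v.ring.valuation (algebraMap _ W.FunctionField (vertical W Q)) =
      v.ring.valuation (fn W (C X) / fn W X) ^ (-2 : ℤ) := by
  obtain ⟨s, hs⟩ : ∃ s, s = v.ring.valuation (fn W (C X) / fn W X) := ⟨_, rfl⟩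
  obtain ⟨-, -, hX, -⟩ := valuation_X_Y_eq hv hs
  cases Q with
  | zero => exact absurd rfl hQ
  | some x y h =>
    have := valuation_fn_C hv (X_sub_C_ne_zero x)
    rw [natDegree_X_sub_C, pow_one, hX, hs] at this
    exact this

/-- A function with at most simple poles, all of them in `T ∪ {0}`, has at most `|T| + 1` zeros, and
if it has that many, the sum of its zeros equals the sum of its poles. -/
theorem card_zeros_le [DecidableEq K] {T A : Finset W.Point} (hT : 0 ∉ T) (hA : 0 ∉ A)
    (hAT : ∀ P ∈ A, P ∉ T ∧ -P ∉ T) (c : K) (a : W.Point → K) {f : W.FunctionField} (hf : f ≠ 0)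
    (hfc : f = algebraMap K _ c + ∑ Q ∈ T, a Q • poleFn W Q)
    (hzero : ∀ P ∈ A, ∀ v : Place K W.FunctionField, v.IsCenter (pointIdeal W P) →
      v.ring.valuation f < 1) :
    A.card ≤ T.card + 1 ∧ (A.card = T.card + 1 → ∑ P ∈ A, P = ∑ Q ∈ T, Q) := by
  have hT0 : ∀ Q ∈ T, Q ≠ 0 := fun Q hQ h0 => hT (h0 ▸ hQ)
  have hA0 : ∀ Q ∈ A, Q ≠ 0 := fun Q hQ h0 => hA (h0 ▸ hQ)
  -- Multiplication by `V` clears the poles of `f` in `T`. The resulting regular function also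
  -- vanishes on `-T`, because both `X - x(Q)` and the numerator of `poleFn Q` vanish at `-Q`.
  set V := ∏ Q ∈ T, vertical W Q with hV
  have hVmem : ∀ Q ∈ T, V ∈ pointIdeal W (-Q) := fun Q hQ =>
    Ideal.mem_of_dvd _ (Finset.dvd_prod_of_mem _ hQ) (vertical_mem_neg (hT0 Q hQ))
  have hV0 : V ≠ 0 := Finset.prod_ne_zero_iff.mpr fun Q _ => vertical_ne_zero Q
  have hinj := IsFractionRing.injective W.CoordinateRing W.FunctionField
  obtain ⟨r, hrmem, hr⟩ : ∃ r, (∀ Q ∈ T, r ∈ pointIdeal W (-Q)) ∧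
      f * algebraMap _ _ V = algebraMap _ W.FunctionField r := by
    have hterm : ∀ Q ∈ T, ∃ r, (∀ R ∈ T, r ∈ pointIdeal W (-R)) ∧
        poleFn W Q * algebraMap _ _ V = algebraMap _ W.FunctionField r := by
      intro Q hQ
      obtain ⟨r, hr, e⟩ := exists_poleFn_mul_vertical (hT0 Q hQ)
      refine ⟨r * ∏ R ∈ T.erase Q, vertical W R, fun R hR => ?_, ?_⟩
      · by_cases hRQ : R = Q
        · rw [hRQ]; exact Ideal.mul_mem_right _ _ hr
        · exact Ideal.mul_mem_left _ _ (Ideal.mem_of_dvd _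
            (Finset.dvd_prod_of_mem _ (Finset.mem_erase.mpr ⟨hRQ, hR⟩))
            (vertical_mem_neg (hT0 R hR)))
      · rw [hV, ← Finset.mul_prod_erase _ _ hQ, map_mul, ← mul_assoc, e, map_mul]
    choose! ρ hρ hρ' using hterm
    refine ⟨algebraMap K _ c * V + ∑ Q ∈ T, algebraMap K _ (a Q) * ρ Q, fun R hR => ?_, ?_⟩
    · exact add_mem (Ideal.mul_mem_left _ _ (hVmem R hR))
        (sum_mem fun Q hQ => Ideal.mul_mem_left _ _ (hρ Q hQ R hR))
    · rw [hfc, add_mul, map_add, map_mul, ← IsScalarTower.algebraMap_apply, Finset.sum_mul, map_sum]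
      congr 1
      refine Finset.sum_congr rfl fun Q hQ => ?_
      rw [map_mul, ← IsScalarTower.algebraMap_apply, ← hρ' Q hQ, Algebra.smul_def, mul_assoc]
  have hr0 : r ≠ 0 := by
    rintro rfl
    rw [map_zero] at hr
    exact mul_ne_zero hf (by rwa [Ne, map_eq_zero_iff _ hinj]) hr
  -- At infinity `f` has a pole of order at most one and each factor of `V` one of order two.
  have hdeg : (Algebra.norm K[X] r).natDegree ≤ 2 * T.card + 1 := by
    obtain ⟨v, hv⟩ := exists_place_infinity W
    obtain ⟨s, hs⟩ : ∃ s, s = v.ring.valuation (fn W (C X) / fn W X) := ⟨_, rfl⟩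
    obtain ⟨s0, s1, -, -⟩ := valuation_X_Y_eq hv hs
    have h1 : v.ring.valuation f ≤ s ^ (-1 : ℤ) := by
      have hc : ∀ c : K, v.ring.valuation (algebraMap K W.FunctionField c) ≤ 1 := fun c =>
        (v.ring.valuation_le_one_iff _).mpr (v.const_mem c)
      rw [hfc]
      refine (v.ring.valuation.map_add _ _).trans (max_le ((hc c).trans ?_)
        (v.ring.valuation.map_sum_le fun Q hQ => ?_))
      · exact one_le_zpow_of_nonpos₀ s0 s1.le (by norm_num)
      · rw [Algebra.smul_def, map_mul, valuation_poleFn_infinity hv (hT0 Q hQ), ← hs, zpow_neg_one]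
        exact mul_le_of_le_one_left' (hc _)
    have h2 : v.ring.valuation (algebraMap _ W.FunctionField V) = s ^ (-2 * T.card : ℤ) := by
      rw [hV, map_prod, map_prod,
        Finset.prod_congr rfl fun Q hQ => valuation_vertical hv (hT0 Q hQ),
        Finset.prod_const, ← hs, ← zpow_natCast, ← zpow_mul]
    have h3 := valuation_algebraMap_eq hv hr0
    rw [← hr, map_mul, h2, ← hs] at h3
    have h4 : s ^ (-(Algebra.norm K[X] r).natDegree : ℤ) ≤ s ^ (-1 + -2 * T.card : ℤ) := by
      rw [← h3, zpow_add₀ s0.ne']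
      exact mul_le_mul_left h1 _
    rw [zpow_le_zpow_iff_right_of_lt_one₀ s0 s1] at h4
    omega
  have hAmem : ∀ P ∈ A, r ∈ pointIdeal W P := by
    intro P hP
    obtain ⟨v, hv⟩ := exists_isCenter_pointIdeal (hA0 P hP)
    rw [← (hv r).2, ← hr, map_mul]
    exact (mul_le_of_le_one_right' ((v.ring.valuation_le_one_iff _).mpr (hv V).1)).trans_lt
      (hzero P hP v hv)
  classical
  -- The function `r` vanishes on the disjoint union of `A` and `-T`, so `|A| + |T| ≤ 2 |T| + 1`. In
  -- case of equality these points sum to zero, that is, the sums over `A` and `T` agree.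
  let T' := T.map (Equiv.neg W.Point).toEmbedding
  have hdisj : Disjoint A T' := by
    rw [Finset.disjoint_left]
    intro P hP hPT
    obtain ⟨Q, hQ, rfl⟩ := Finset.mem_map.mp hPT
    exact (hAT _ hP).2 (by simpa using hQ)
  have hcard : (A.disjUnion T' hdisj).card = A.card + T.card := by
    rw [Finset.card_disjUnion, Finset.card_map]
  obtain ⟨h1, h2⟩ := card_le_natDegree_norm (B := A.disjUnion T' hdisj) (r := r) (by
    rw [Finset.mem_disjUnion, not_or]
    refine ⟨hA, fun h => ?_⟩
    obtain ⟨Q, hQ, e⟩ := Finset.mem_map.mp h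
    exact hT0 Q hQ (by simpa using e)) hr0 (by
    intro Q hQ
    rcases Finset.mem_disjUnion.mp hQ with h | h
    · exact hAmem Q h
    · obtain ⟨R, hR, rfl⟩ := Finset.mem_map.mp h
      exact hrmem R hR)
  rw [hcard] at h1 h2
  refine ⟨by omega, fun hAc => ?_⟩
  have h3 := h2 (by omega)
  rw [Finset.sum_disjUnion, Finset.sum_map] at h3
  simp only [Equiv.coe_toEmbedding, Equiv.neg_apply] at h3
  rwa [Finset.sum_neg_distrib, add_neg_eq_zero] at h3

end Zeros

/-! ### A criterion for MDS codes, and sets with prescribed subset sums avoided -/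

section Codes

variable {K V ι : Type*} [Field K] [AddCommGroup V] [Module K V] [Fintype ι]

/-- A linear map is an MDS code if every nonzero codeword has fewer zeros than the dimension. -/
theorem isMDS_of_card_zeros_lt [FiniteDimensional K V] {e : V → ι → K} (he : IsLinearMap K e)
    (hle : finrank K V ≤ Fintype.card ι)
    (hz : ∀ x, x ≠ 0 → ∀ Z : Finset ι, (∀ i ∈ Z, e x i = 0) → Z.card < finrank K V) :
    IsMDS K e := by
  classical
  let φ : V →ₗ[K] (ι → K) := he.mk' e
  have hφ : ∀ x, φ x = e x := fun _ => rfl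
  have hinj : Function.Injective φ := by
    rw [injective_iff_map_eq_zero]
    intro x hx
    by_contra hx0
    have := hz x hx0 Finset.univ fun i _ => congrFun hx i
    rw [Finset.card_univ] at this
    omega
  refine ⟨he, hinj, fun hV => ?_⟩
  have hweight : ∀ x, hammingNorm (e x) + (Finset.univ.filter fun i => e x i = 0).card =
      Fintype.card ι := by
    intro x
    rw [add_comm, hammingNorm, Finset.card_filter_add_card_filter_not, Finset.card_univ]
  have hpos : 0 < finrank K V := finrank_pos
  -- Vanishing at `dim V - 1` positions imposes too few conditions to force `x = 0`. The word found
  -- here has exactly these zeros, and its weight attains the bound that holds for all non-zero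
  -- words.
  obtain ⟨Z, -, hZ⟩ := Finset.exists_subset_card_eq
    (s := (Finset.univ : Finset ι)) (n := finrank K V - 1) (by rw [Finset.card_univ]; omega)
  let π : V →ₗ[K] (Z → K) := (LinearMap.funLeft K K (fun i : Z => (i : ι))).comp φ
  have hker : ¬ Function.Injective π := by
    intro h
    have := LinearMap.finrank_le_finrank_of_injective h
    rw [finrank_fintype_fun_eq_card, Fintype.card_coe, hZ] at this
    omega
  rw [injective_iff_map_eq_zero] at hker
  push Not at hker
  obtain ⟨x, hx, hx0⟩ := hker
  have hxZ : ∀ i ∈ Z, e x i = 0 := fun i hi => congrFun hx ⟨i, hi⟩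
  have hcard : (Finset.univ.filter fun i => e x i = 0).card = finrank K V - 1 := by
    have h1 := hz x hx0 (Finset.univ.filter fun i => e x i = 0) (by simp)
    have h2 : Z ⊆ Finset.univ.filter fun i => e x i = 0 := fun i hi => by simpa using hxZ i hi
    have := Finset.card_le_card h2
    omega
  have hmin : minDist e = Fintype.card ι + 1 - finrank K V := by
    unfold minDist
    refine IsLeast.csInf_eq ⟨⟨x, ?_, ?_⟩, ?_⟩
    · exact fun h => hx0 (hinj (by rw [hφ, h, map_zero]))
    · have h1 := hweight x
      have h2 : hammingNorm (e x) = Fintype.card ι + 1 - finrank K V := by omega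
      rw [← h2]
    · rintro w ⟨y, hy, rfl⟩
      have hy0 : y ≠ 0 := by rintro rfl; exact hy (map_zero φ)
      have h1 := hz y hy0 (Finset.univ.filter fun i => e y i = 0) (by simp)
      have h2 := hweight y
      have h3 : Fintype.card ι + 1 - finrank K V ≤ hammingNorm (e y) := by omega
      convert! h3
  rw [hmin]
  omega

/-- In an infinite abelian group there are arbitrarily large finite sets that avoid a given finite
set and none of whose nonempty subsets has its sum in another given finite set. -/
theorem exists_finset_sum_notMem {A : Type*} [AddCommGroup A] [Infinite A] (B C : Finset A)
    (m : ℕ) : ∃ S : Finset A, S.card = m ∧ Disjoint S B ∧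
      ∀ T ⊆ S, T.Nonempty → ∑ x ∈ T, x ∉ C := by
  classical
  induction m with
  | zero => exact ⟨∅, rfl, Finset.disjoint_empty_left _, fun T hT hne =>
      absurd (Finset.subset_empty.mp hT) hne.ne_empty⟩
  | succ m ih =>
    obtain ⟨S, hS, hSB, hSC⟩ := ih
    -- The new point avoids every `c - ∑ T` with `c ∈ C` and `T ⊆ S`, so subsets containing it do
    -- not have sum in `C`. Subsets without it are covered by induction.
    obtain ⟨a, ha⟩ := Infinite.exists_notMem_finset
      (B ∪ S ∪ Finset.image₂ (fun c T => c - ∑ x ∈ T, x) C S.powerset)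
    simp only [Finset.mem_union, not_or, Finset.mem_image₂, Finset.mem_powerset, not_exists,
      not_and] at ha
    obtain ⟨⟨haB, haS⟩, haC⟩ := ha
    refine ⟨insert a S, by rw [Finset.card_insert_of_notMem haS, hS], ?_, fun T hT hne => ?_⟩
    · rw [Finset.disjoint_insert_left]
      exact ⟨haB, hSB⟩
    · by_cases haT : a ∈ T
      · intro hmem
        refine haC _ hmem (T.erase a) (Finset.subset_insert_iff.mp hT) ?_
        rw [← Finset.add_sum_erase _ _ haT]
        abel
      · exact hSC T (fun x hx => (Finset.mem_insert.mp (hT hx)).resolve_left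
          fun h => haT (h ▸ hx)) hne

end Codes

/-! ### Frobenius and the kernels `G_n` -/

section Kernel

open WeierstrassCurve WeierstrassCurve.Affine

variable {k Ω : Type*} [Field k] [Fintype k] [Field Ω] [Algebra k Ω] (E : WeierstrassCurve k)

theorem finite_setOf_pow_eq_self (n : ℕ) (hn : 1 < n) : {x : Ω | x ^ n = x}.Finite := by
  have h0 : (X ^ n - X : Polynomial Ω) ≠ 0 := FiniteField.X_pow_card_sub_X_ne_zero Ω hn
  refine (((X ^ n - X : Polynomial Ω).rootSet_finite Ω)).subset fun x hx => ?_
  rw [mem_rootSet_of_ne h0]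
  simpa [sub_eq_zero] using hx

/-- The Frobenius endomorphism of the group of points. -/
noncomputable def frob {k : Type*} [Field k] [Fintype k] (E : WeierstrassCurve k) (Ω : Type*)
    [Field Ω] [Algebra k Ω] [DecidableEq Ω] : AddMonoid.End (Pt E Ω) :=
  WeierstrassCurve.Affine.Point.map (W' := E.toAffine) (FiniteField.frobeniusAlgHom k Ω)

theorem frob_pow_some [DecidableEq Ω] (n : ℕ) {x y : Ω}
    (h : (E.toAffine.baseChange Ω).Nonsingular x y) :
    ∃ h', (frob E Ω ^ n) (Point.some x y h : Pt E Ω) =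
      Point.some (x ^ Fintype.card k ^ n) (y ^ Fintype.card k ^ n) h' := by
  induction n with
  | zero => simpa using h
  | succ n ih =>
    obtain ⟨h', e⟩ := ih
    have e2 : (frob E Ω ^ (n + 1)) (Point.some x y h : Pt E Ω) =
        frob E Ω ((frob E Ω ^ n) (.some x y h)) := by
      rw [pow_succ']; rfl
    have e3 : ∃ h'', frob E Ω (Point.some (x ^ Fintype.card k ^ n) (y ^ Fintype.card k ^ n) h') =
        Point.some ((x ^ Fintype.card k ^ n) ^ Fintype.card k)
          ((y ^ Fintype.card k ^ n) ^ Fintype.card k) h'' := ⟨_, rfl⟩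
    rw [e2, e]
    simp only [← pow_mul, ← pow_succ] at e3
    exact e3

theorem finite_setOf_frob_pow_eq_self [DecidableEq Ω] {n : ℕ} (hn : n ≠ 0) :
    {Q : Pt E Ω | (frob E Ω ^ n) Q = Q}.Finite := by
  have hf := finite_setOf_pow_eq_self (Ω := Ω) (Fintype.card k ^ n)
    (Nat.one_lt_pow hn Fintype.one_lt_card)
  let g : Pt E Ω → Option (Ω × Ω)
    | .zero => none
    | .some x y _ => some (x, y)
  have hg : Function.Injective g := by
    rintro (_ | ⟨x, y, h⟩) (_ | ⟨x', y', h'⟩) e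
    · rfl
    · cases e
    · cases e
    · simp only [g, Option.some.injEq, Prod.mk.injEq] at e
      obtain ⟨rfl, rfl⟩ := e
      rfl
  refine Set.Finite.of_finite_image (f := g) ?_ hg.injOn
  refine (((hf.prod hf).image some).insert none).subset ?_
  rintro _ ⟨Q, hQ, rfl⟩
  cases Q with
  | zero => exact Set.mem_insert _ _
  | some x y h =>
    refine Set.mem_insert_of_mem _ ⟨(x, y), ?_, rfl⟩
    obtain ⟨h', e⟩ := frob_pow_some E n h
    have hQ' : (frob E Ω ^ n) (Point.some x y h : Pt E Ω) = .some x y h := hQ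
    rw [e, Point.some.injEq] at hQ'
    exact hQ'

theorem tau_eq [DecidableEq Ω] (n : ℕ) : tau E Ω n = ∑ i ∈ Finset.range n, frob E Ω ^ i := rfl

/-- This is the geometric sum `(F - 1) τ_n = F ^ n - 1`. It bounds the coordinates of `G_n` to a
finite field, which makes `G_n` finite. -/
theorem frob_pow_eq_self_of_tau [DecidableEq Ω] {n : ℕ} {Q : Pt E Ω} (h : tau E Ω n Q = 0) :
    (frob E Ω ^ n) Q = Q := by
  have e := mul_geom_sum (frob E Ω) n
  rw [← tau_eq] at e
  have e2 := congrArg (fun f : AddMonoid.End (Pt E Ω) => f Q) e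
  have e3 : (frob E Ω ^ n) Q - Q = frob E Ω (tau E Ω n Q) - tau E Ω n Q := e2.symm
  rw [h, map_zero, sub_zero, sub_eq_zero] at e3
  exact e3

theorem mem_kernelSet [DecidableEq Ω] {n : ℕ} {Q : Pt E Ω} :
    Q ∈ kernelSet E Ω n ↔ tau E Ω n Q = 0 := by
  unfold kernelSet
  simp only [Set.mem_ofPred_eq]
  have : ‹DecidableEq Ω› = fun a b => Classical.propDecidable (a = b) := Subsingleton.elim _ _
  subst this
  rfl

theorem finite_kernelSet {n : ℕ} (hn : n ≠ 0) : (kernelSet E Ω n).Finite := by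
  classical
  refine (finite_setOf_frob_pow_eq_self E (Ω := Ω) hn).subset fun Q hQ => ?_
  exact frob_pow_eq_self_of_tau E ((mem_kernelSet E).mp hQ)

theorem zero_mem_kernelSet (n : ℕ) : (0 : Pt E Ω) ∈ kernelSet E Ω n := by
  classical
  rw [mem_kernelSet, map_zero]

theorem neg_mem_kernelSet {n : ℕ} {Q : Pt E Ω} (hQ : Q ∈ kernelSet E Ω n) :
    -Q ∈ kernelSet E Ω n := by
  classical
  rw [mem_kernelSet] at hQ ⊢
  rw [map_neg, hQ, neg_zero]

theorem tau_eq_nsmul [DecidableEq Ω] {Q : Pt E Ω} (h : frob E Ω Q = Q) (n : ℕ) :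
    tau E Ω n Q = n • Q := by
  have hp : ∀ i : ℕ, (frob E Ω ^ i) Q = Q := by
    intro i
    induction i with
    | zero => rfl
    | succ i ih =>
      have : (frob E Ω ^ (i + 1)) Q = (frob E Ω ^ i) (frob E Ω Q) := by rw [pow_succ]; rfl
      rw [this, h, ih]
  induction n with
  | zero => rw [zero_nsmul]; rfl
  | succ n ih =>
    have : tau E Ω (n + 1) Q = tau E Ω n Q + (frob E Ω ^ n) Q := by
      rw [tau_eq, Finset.sum_range_succ]; rfl
    rw [this, ih, hp, succ_nsmul]

/-- Being fixed by `F ^ r` and `F ^ s` with coprime exponents, `Q` is fixed by `F`. Then `τ_r` and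
`τ_s` act on it as multiplication by `r` and `s`, so its order divides both. -/
theorem kernelSet_inter_eq_zero {r s : ℕ} (hrs : r.Coprime s) {Q : Pt E Ω}
    (hr : Q ∈ kernelSet E Ω r) (hs : Q ∈ kernelSet E Ω s) : Q = 0 := by
  classical
  rw [mem_kernelSet] at hr hs
  have h1 := frob_pow_eq_self_of_tau E hr
  have h2 := frob_pow_eq_self_of_tau E hs
  have hit : ∀ n : ℕ, (frob E Ω ^ n) Q = (frob E Ω)^[n] Q := fun n => by
    rw [AddMonoid.End.coe_pow]
  rw [hit] at h1 h2
  have h3 : Function.IsPeriodicPt (frob E Ω) (Nat.gcd r s) Q :=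
    Function.IsPeriodicPt.gcd (f := frob E Ω) h1 h2
  rw [hrs] at h3
  have h4 : frob E Ω Q = Q := h3
  rw [tau_eq_nsmul E h4] at hr hs
  have h5 := addOrderOf_dvd_of_nsmul_eq_zero hr
  have h6 := addOrderOf_dvd_of_nsmul_eq_zero hs
  exact AddMonoid.addOrderOf_eq_one_iff.mp (Nat.eq_one_of_dvd_coprimes hrs h5 h6)

end Kernel

/-- Over an algebraically closed field each of the infinitely many `x` is the abscissa of a point,
the equation being monic quadratic in `Y`. -/
theorem infinite_pt {k Ω : Type*} [Field k] [Field Ω] [Algebra k Ω] (E : WeierstrassCurve k)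
    [IsAlgClosed Ω] [E.IsElliptic] : Infinite (Pt E Ω) := by
  open WeierstrassCurve WeierstrassCurve.Affine in
  have hy : ∀ x : Ω, ∃ y, (E.toAffine.baseChange Ω).Equation x y := by
    intro x
    let p : Polynomial Ω := (E.toAffine.baseChange Ω).polynomial.map (evalRingHom x)
    have hmonic : (E.toAffine.baseChange Ω).polynomial.Monic := monic_polynomial
    have hdeg : p.degree ≠ 0 := by
      rw [hmonic.degree_map, degree_polynomial]
      decide
    obtain ⟨y, hy⟩ := IsAlgClosed.exists_root p hdeg
    refine ⟨y, ?_⟩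
    rwa [IsRoot, map_evalRingHom_eval] at hy
  choose y hy using hy
  have : (E.toAffine.baseChange Ω).IsElliptic :=
    inferInstanceAs ((WeierstrassCurve.map E (algebraMap k Ω)).IsElliptic)
  refine Infinite.of_injective (fun x : Ω => (Point.mk (hy x) : Pt E Ω)) fun x x' h => ?_
  simp only [Point.mk, Point.some.injEq] at h
  exact h.1

/-! ### Geometric points over `Ω` and places of the function field over `K` -/

section Transfer

open WeierstrassCurve WeierstrassCurve.Affine

open scoped Classical

variable {k Ω : Type*} [Field k] [Field Ω] [Algebra k Ω]

/-- The inclusion `E(K) → E(Ω)`. -/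
noncomputable def incl (E : WeierstrassCurve k) (K : IntermediateField k Ω) : Pt E K →+ Pt E Ω :=
  WeierstrassCurve.Affine.Point.map (W' := E.toAffine) K.val

variable {E : WeierstrassCurve k} {K : IntermediateField k Ω}

theorem incl_injective : Function.Injective (incl E K) := by
  exact Point.map_injective (W' := E.toAffine) K.val

theorem isRational_iff {Q : Pt E Ω} : IsRational E K Q ↔ ∃ R, incl E K R = Q := Iff.rfl

theorem incl_ne_zero {R : Pt E K} (hR : R ≠ 0) : incl E K R ≠ 0 := by
  rwa [Ne, map_eq_zero_iff _ incl_injective]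

variable {v : Place K (FunField E K)}

theorem liesBelow_zero : LiesBelow v (0 : Pt E Ω) ↔ fn (E.toAffine.baseChange K) (C X) ∉ v.ring :=
  Iff.rfl

theorem isCenter_iff_forall_mk {m : Ideal (E.toAffine.baseChange K).CoordinateRing} :
    v.IsCenter m ↔ ∀ p : K[X][X], polyFun E K p ∈ v.ring ∧
      (v.ring.valuation (polyFun E K p) < 1 ↔
        CoordinateRing.mk (E.toAffine.baseChange K) p ∈ m) := by
  constructor
  · exact fun h p => h (CoordinateRing.mk _ p)
  · intro h r
    obtain ⟨p, rfl⟩ := AdjoinRoot.mk_surjective r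
    exact h p

theorem liesBelow_incl {R : Pt E K} (hR : R ≠ 0) :
    LiesBelow v (incl E K R) ↔ v.IsCenter (pointIdeal (E.toAffine.baseChange K) R) := by
  cases R with
  | zero => exact absurd rfl hR
  | some x y h =>
    rw [isCenter_iff_forall_mk]
    refine forall_congr' fun p => and_congr_right fun _ => ?_
    rw [mk_mem_pointIdeal_some]
    have : (p.map (mapRingHom (algebraMap K Ω))).evalEval (algebraMap K Ω x) (algebraMap K Ω y) =
        algebraMap K Ω (p.evalEval x y) := map_mapRingHom_evalEval ..
    have h0 : (p.map (mapRingHom (algebraMap K Ω))).evalEval (K.val x) (K.val y) = 0 ↔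
        p.evalEval x y = 0 := by
      rw [← map_eq_zero_iff (algebraMap K Ω) (algebraMap K Ω).injective, ← this]
      rfl
    rw [h0]

/-- A condition imposed at geometric points thus reaches every affine place, also those whose
residue field is larger than `K`. -/
theorem exists_liesBelow [IsAlgClosed Ω] [E.IsElliptic]
    {m : Ideal (E.toAffine.baseChange K).CoordinateRing}
    [m.IsMaximal] (hc : v.IsCenter m) : ∃ Q : Pt E Ω, Q ≠ 0 ∧ LiesBelow v Q := by
  obtain ⟨x, y, h, hm⟩ := exists_point_of_isMaximal Ω m
  have e : (E.toAffine.baseChange K).map (algebraMap K Ω) = E.toAffine.baseChange Ω :=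
    WeierstrassCurve.map_baseChange (W := E) (S := k) (A := K) (B := Ω) K.val
  rw [e] at h
  have : (E.toAffine.baseChange Ω).IsElliptic :=
    inferInstanceAs ((WeierstrassCurve.map E (algebraMap k Ω)).IsElliptic)
  refine ⟨.some x y (equation_iff_nonsingular.mp h), Point.some_ne_zero _, fun p => ?_⟩
  rw [← hm]
  exact isCenter_iff_forall_mk.mp hc p

theorem LiesBelow.exists_isCenter {Q : Pt E Ω} (hQ : Q ≠ 0) (h : LiesBelow v Q) :
    ∃ m : Ideal (E.toAffine.baseChange K).CoordinateRing, m.IsPrime ∧ m ≠ ⊥ ∧ v.IsCenter m := by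
  cases Q with
  | zero => exact absurd rfl hQ
  | some x y hn =>
    refine v.exists_center fun r => ?_
    obtain ⟨p, rfl⟩ := AdjoinRoot.mk_surjective r
    exact (h p).1

theorem eq_incl_of_liesBelow {Q : Pt E Ω} (hQ : Q ≠ 0) {R : Pt E K} (h : LiesBelow v Q)
    (hc : v.IsCenter (pointIdeal (E.toAffine.baseChange K) R)) : Q = incl E K R := by
  cases Q with
  | zero => exact absurd rfl hQ
  | some x y hn =>
    have hR := hc.ne_zero
    cases R with
    | zero => exact absurd rfl hR
    | some x' y' hn' =>
      have hx := ((h (C (X - C x'))).2.symm.trans (isCenter_iff_forall_mk.mp hc _).2).mpr (by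
        rw [mk_mem_pointIdeal_some]; simp [evalEval])
      have hy := ((h (X - C (C y'))).2.symm.trans (isCenter_iff_forall_mk.mp hc _).2).mpr (by
        rw [mk_mem_pointIdeal_some]; simp [evalEval])
      simp [evalEval, sub_eq_zero] at hx hy
      subst hx hy
      rfl

theorem isCenter_unique {m m' : Ideal (E.toAffine.baseChange K).CoordinateRing}
    (h : v.IsCenter m) (h' : v.IsCenter m') : m = m' :=
  Ideal.ext fun r => (h r).2.symm.trans (h' r).2

theorem isElliptic_baseChange (E : WeierstrassCurve k) [E.IsElliptic] (L : Type*) [Field L]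
    [Algebra k L] : (E.toAffine.baseChange L).IsElliptic :=
  inferInstanceAs ((WeierstrassCurve.map E (algebraMap k L)).IsElliptic)

theorem valuation_le_one_of_ordGE [E.IsElliptic]
    {m : Ideal (E.toAffine.baseChange K).CoordinateRing} [m.IsPrime]
    (hm : m ≠ ⊥) (hc : v.IsCenter m) {f : FunField E K} {n : ℤ} (hn : 0 ≤ n) (hf : v.OrdGE f n) :
    v.ring.valuation f ≤ 1 := by
  have := isElliptic_baseChange E K
  obtain ⟨t, ht⟩ := hc.exists_isUniformizer_of_isDedekindDomain hm
  exact ((ht.ordGE_iff f n).mp hf).trans (by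
    rw [← zpow_zero (v.ring.valuation t), zpow_le_zpow_iff_right_of_lt_one₀ ht.pos ht.1]
    exact hn)

theorem exists_eq_sum_of_mem_rrSpace [IsAlgClosed Ω] [E.IsElliptic] {D : Divisor E Ω}
    {T : Finset (Pt E K)} (h0 : D 0 ≤ 1) (hT : ∀ Q ∈ T, D (incl E K Q) ≤ 1)
    (hn : ∀ Q, Q ≠ 0 → (∀ R ∈ T, Q ≠ incl E K R) → D Q ≤ 0) {f : FunField E K}
    (hf : f ∈ rrSpace K D) :
    ∃ (c : K) (a : Pt E K → K), f = algebraMap K _ c +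
      ∑ Q ∈ T, a Q • poleFn (E.toAffine.baseChange K) Q := by
  have := isElliptic_baseChange E K
  refine mem_span_poleFn T (fun v hv => ?_) (fun v m hc hmT => ?_) (fun v Q hQ hc => ?_)
  · have hu := isUniformizer_X_div_Y hv
    refine ((hu.ordGE_iff f _).mp (hf v 0 (liesBelow_zero.mpr hv))).trans ?_
    rw [← zpow_neg_one, zpow_le_zpow_iff_right_of_lt_one₀ hu.pos hu.1]
    omega
  · obtain ⟨m', hm', hbot, hc'⟩ := v.exists_center fun r => (hc r).1
    obtain rfl := isCenter_unique hc hc'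
    have := hm'.isMaximal hbot
    obtain ⟨Q, hQ0, hQ⟩ := exists_liesBelow hc
    refine valuation_le_one_of_ordGE hbot hc (n := -D Q) ?_ (hf v Q hQ)
    have := hn Q hQ0 fun R hR e => by
      have hR0 : R ≠ 0 := by rintro rfl; rw [map_zero] at e; exact hQ0 e
      subst e
      exact hmT R hR (isCenter_unique hc ((liesBelow_incl hR0).mp hQ))
    omega
  · have hu := hc.isUniformizer_poleFn
    have h1 := (hu.ordGE_iff f _).mp (hf v _ ((liesBelow_incl hc.ne_zero).mpr hc))
    refine h1.trans ?_
    have h2 : v.ring.valuation (poleFn (E.toAffine.baseChange K) Q) =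
        v.ring.valuation (poleFn (E.toAffine.baseChange K) Q)⁻¹ ^ (-1 : ℤ) := by
      rw [zpow_neg_one, map_inv₀, inv_inv]
    rw [h2, zpow_le_zpow_iff_right_of_lt_one₀ hu.pos hu.1]
    have := hT Q hQ
    omega

theorem algebraMap_mem_rrSpace {D : Divisor E Ω} (hD : 0 ≤ D) (c : K) :
    algebraMap K (FunField E K) c ∈ rrSpace K D := fun v Q _ =>
  Place.ordGE_of_le_one ((v.ring.valuation_le_one_iff _).mpr (v.const_mem c))
    (neg_nonpos.mpr (hD Q))

theorem poleFn_mem_rrSpace {D : Divisor E Ω} (hD : 0 ≤ D) {R : Pt E K} (h0 : 1 ≤ D 0)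
    (hR : 1 ≤ D (incl E K R)) (hR0 : R ≠ 0) :
    poleFn (E.toAffine.baseChange K) R ∈ rrSpace K D := by
  intro v Q hQ
  by_cases hQ0 : Q = 0
  · subst hQ0
    have hu := isUniformizer_X_div_Y (liesBelow_zero.mp hQ)
    rw [hu.ordGE_iff, valuation_poleFn_infinity (liesBelow_zero.mp hQ) hR0, ← zpow_neg_one,
      zpow_le_zpow_iff_right_of_lt_one₀ hu.pos hu.1]
    omega
  · obtain ⟨m, hm, hbot, hc⟩ := hQ.exists_isCenter hQ0
    by_cases hmR : m = pointIdeal (E.toAffine.baseChange K) R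
    · subst hmR
      have hu := hc.isUniformizer_poleFn
      have h2 : v.ring.valuation (poleFn (E.toAffine.baseChange K) R) =
          v.ring.valuation (poleFn (E.toAffine.baseChange K) R)⁻¹ ^ (-1 : ℤ) := by
        rw [zpow_neg_one, map_inv₀, inv_inv]
      rw [hu.ordGE_iff, h2, zpow_le_zpow_iff_right_of_lt_one₀ hu.pos hu.1,
        eq_incl_of_liesBelow hQ0 hQ hc]
      omega
    · exact Place.ordGE_of_le_one (hc.poleFn_le_one hmR) (neg_nonpos.mpr (hD Q))

theorem hasValue_incl_iff {R : Pt E K} (hR : R ≠ 0) {f : FunField E K} {c : K} :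
    HasValue f (incl E K R) c ↔ ∀ v : Place K (FunField E K),
      v.IsCenter (pointIdeal (E.toAffine.baseChange K) R) →
        v.ring.valuation (f - algebraMap K _ c) < 1 :=
  forall_congr' fun _ => imp_congr_left (liesBelow_incl hR)

/-- Uniqueness of the value rests on the existence of a place centered at `R`; without one,
`HasValue` would hold for every constant. -/
theorem evalAt_eq {R : Pt E K} (hR : R ≠ 0) {f : FunField E K} {c : K}
    (h : HasValue f (incl E K R) c) : evalAt f (incl E K R) = c := by
  have hex : ∃ c, HasValue f (incl E K R) c := ⟨c, h⟩
  rw [evalAt, dif_pos hex]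
  obtain ⟨v, hv⟩ := exists_isCenter_pointIdeal (W := E.toAffine.baseChange K) hR
  exact v.eq_of_valuation_sub_lt_one ((hasValue_incl_iff hR).mp hex.choose_spec v hv)
    ((hasValue_incl_iff hR).mp h v hv)

theorem exists_hasValue [E.IsElliptic] {D : Divisor E Ω} {R : Pt E K} (hR : R ≠ 0)
    (hD : D (incl E K R) = 0) {f : FunField E K} (hf : f ∈ rrSpace K D) :
    ∃ c, HasValue f (incl E K R) c := by
  obtain ⟨v, hv⟩ := exists_isCenter_pointIdeal (W := E.toAffine.baseChange K) hR
  have := (pointIdeal_isMaximal hR).isPrime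
  have h1 : v.ring.valuation f ≤ 1 := valuation_le_one_of_ordGE (pointIdeal_ne_bot R) hv
    (n := -D (incl E K R)) (by rw [hD, neg_zero]) (hf v _ ((liesBelow_incl hR).mpr hv))
  obtain ⟨c, hc⟩ := hv.exists_value h1
  exact ⟨c, (hasValue_incl_iff hR).mpr hc⟩

theorem HasValue.add {f g : FunField E K} {Q : Pt E Ω} {c d : K} (hf : HasValue f Q c)
    (hg : HasValue g Q d) : HasValue (f + g) Q (c + d) := by
  intro v hv
  rw [map_add, add_sub_add_comm]
  exact v.ring.valuation.map_add_lt (hf v hv) (hg v hv)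

theorem HasValue.smul {f : FunField E K} {Q : Pt E Ω} {c : K} (hf : HasValue f Q c) (a : K) :
    HasValue (a • f) Q (a * c) := by
  intro v hv
  rw [map_mul, Algebra.smul_def, ← mul_sub, map_mul]
  exact (mul_le_of_le_one_left' ((v.ring.valuation_le_one_iff _).mpr (v.const_mem a))).trans_lt
    (hf v hv)

end Transfer

/-! ### Direct sums from disjoint parts of a linearly independent family -/

section DirectSum

theorem isDirectSum_span_image {K V ι J : Type*} [Field K] [AddCommGroup V] [Module K V]
    {g : ι → V} (hg : LinearIndependent K g) {s : J → Set ι}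
    (hs : Pairwise fun i j => Disjoint (s i) (s j)) :
    IsDirectSum (Submodule.span K (g '' ⋃ j, s j)) fun j => Submodule.span K (g '' s j) := by
  refine ⟨fun i => ?_, by rw [Set.image_iUnion, Submodule.span_iUnion]⟩
  have h1 : ⨆ j, ⨆ _ : j ≠ i, Submodule.span K (g '' s j) ≤
      Submodule.span K (g '' ⋃ j, ⋃ _ : j ≠ i, s j) :=
    iSup₂_le fun j hj => Submodule.span_mono (Set.image_mono (Set.subset_iUnion₂_of_subset j hj
      subset_rfl))
  refine (hg.disjoint_span_image ?_).mono_right h1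
  rw [Set.disjoint_iUnion₂_right]
  exact fun j hj => hs hj.symm

end DirectSum

/-! ### Bases of `L_0(D)` and the MDS property for reduced divisors -/

section Code

open WeierstrassCurve WeierstrassCurve.Affine

open scoped Classical

variable {k Ω : Type*} [Field k] [Field Ω] [Algebra k Ω] {E : WeierstrassCurve k}
  {K : IntermediateField k Ω}

/-- `D` is the reduced divisor `(T) + (0)`; if `T` is empty, `D` may be zero as well. -/
structure Divisor.IsReduced (D : Divisor E Ω) (T : Finset (Pt E K)) : Prop where
  zero_notMem : 0 ∉ T
  nonneg : 0 ≤ D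
  le_one : ∀ Q, D Q ≤ 1
  eq_zero : ∀ Q, Q ≠ 0 → (∀ R ∈ T, Q ≠ incl E K R) → D Q = 0
  one_le : ∀ R ∈ T, 1 ≤ D (incl E K R)
  one_le_zero : T.Nonempty → 1 ≤ D 0

variable {D : Divisor E Ω} {T : Finset (Pt E K)}

theorem Divisor.IsReduced.ne_zero (h : D.IsReduced T) {Q : Pt E K} (hQ : Q ∈ T) : Q ≠ 0 := by
  rintro rfl
  exact h.zero_notMem hQ

theorem Divisor.IsReduced.incl_eq_zero (h : D.IsReduced T) {P : Pt E K} (hP : P ≠ 0)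
    (hPT : P ∉ T) : D (incl E K P) = 0 :=
  h.eq_zero _ (incl_ne_zero hP) fun _ hR e => hPT (incl_injective e ▸ hR)

theorem Divisor.IsReduced.exists_eq_sum [IsAlgClosed Ω] [E.IsElliptic] (h : D.IsReduced T)
    {f : FunField E K} (hf : f ∈ rrSpace K D) :
    ∃ (c : K) (a : Pt E K → K), f = algebraMap K _ c +
      ∑ Q ∈ T, a Q • poleFn (E.toAffine.baseChange K) Q :=
  exists_eq_sum_of_mem_rrSpace (h.le_one 0) (fun _ _ => h.le_one _)
    (fun Q hQ hR => (h.eq_zero Q hQ hR).le) hf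

theorem hasValue_poleFn {P Q : Pt E K} (hP : P ≠ 0) (hPQ : P ≠ Q) :
    HasValue (poleFn (E.toAffine.baseChange K) Q) (incl E K P)
      (evalAt (poleFn (E.toAffine.baseChange K) Q) (incl E K P)) := by
  obtain ⟨v, hv⟩ := exists_isCenter_pointIdeal (W := E.toAffine.baseChange K) hP
  obtain ⟨c, hc⟩ : ∃ c, HasValue (poleFn (E.toAffine.baseChange K) Q) (incl E K P) c := by
    have h1 : v.ring.valuation (poleFn (E.toAffine.baseChange K) Q) ≤ 1 := by
      by_cases hQ : Q = 0
      · rw [hQ, poleFn_zero, map_one]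
      · exact hv.poleFn_le_one fun e => hPQ (pointIdeal_injOn hP hQ e)
    obtain ⟨c, hc⟩ := hv.exists_value h1
    exact ⟨c, (hasValue_incl_iff hP).mpr hc⟩
  rwa [evalAt_eq hP hc]

/-- The function `poleFn Q`, normalized to vanish at `P`. -/
noncomputable def normFn (P : Pt E K) (Q : {Q : Pt E K // Q ≠ 0}) : FunField E K :=
  poleFn (E.toAffine.baseChange K) Q -
    algebraMap K _ (evalAt (poleFn (E.toAffine.baseChange K) Q) (incl E K P))

theorem linearIndependent_normFn (P : Pt E K) : LinearIndependent K (normFn P) :=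
  linearIndependent_poleFn_sub (W := E.toAffine.baseChange K)
    fun Q => evalAt (poleFn (E.toAffine.baseChange K) Q) (incl E K P)

/-- `L_0(D)` has the basis of normalized functions with a simple pole at a point of `T`. -/
theorem rrSpace₀_eq_span [IsAlgClosed Ω] [E.IsElliptic] (h : D.IsReduced T) {P : Pt E K}
    (hP : P ≠ 0) (hPT : P ∉ T) :
    rrSpace₀ K D (incl E K P) = Submodule.span K (normFn P '' {Q | (Q : Pt E K) ∈ T}) := by
  apply le_antisymm
  · rintro f ⟨hf, hfP⟩
    obtain ⟨c, a, hca⟩ := h.exists_eq_sum hf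
    set ev : Pt E K → K := fun Q => evalAt (poleFn (E.toAffine.baseChange K) Q) (incl E K P)
      with hev
    -- Rewritten in the normalized functions, which all vanish at `P`. The constant term is then the
    -- value of `f` at `P`, hence zero.
    have hsum : f = algebraMap K _ (c + ∑ Q ∈ T, a Q * ev Q) +
        ∑ Q ∈ T, a Q • (poleFn (E.toAffine.baseChange K) Q - algebraMap K _ (ev Q)) := by
      rw [hca, map_add, map_sum, add_assoc, ← Finset.sum_add_distrib]
      congr 1
      refine Finset.sum_congr rfl fun Q _ => ?_
      rw [map_mul, Algebra.smul_def, Algebra.smul_def]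
      ring
    obtain ⟨v, hv⟩ := exists_isCenter_pointIdeal (W := E.toAffine.baseChange K) hP
    have hlt : v.ring.valuation (∑ Q ∈ T, a Q •
        (poleFn (E.toAffine.baseChange K) Q - algebraMap K _ (ev Q))) < 1 := by
      refine v.ring.valuation.map_sum_lt' one_pos fun Q hQ => ?_
      rw [Algebra.smul_def, map_mul]
      refine (mul_le_of_le_one_left' ((v.ring.valuation_le_one_iff _).mpr
        (v.const_mem (a Q)))).trans_lt ?_
      exact (hasValue_incl_iff hP).mp (hasValue_poleFn hP fun e => hPT (e ▸ hQ)) v hv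
    have hc0 : c + ∑ Q ∈ T, a Q * ev Q = 0 := by
      refine v.eq_of_valuation_sub_lt_one (f := f) ?_ ((hasValue_incl_iff hP).mp hfP v hv)
      rwa [hsum, add_sub_cancel_left]
    rw [hsum, hc0, map_zero, zero_add]
    refine sum_mem fun Q hQ => Submodule.smul_mem _ _ (Submodule.subset_span
      ⟨⟨Q, h.ne_zero hQ⟩, hQ, rfl⟩)
  · rw [Submodule.span_le]
    rintro _ ⟨Q, hQ, rfl⟩
    refine ⟨sub_mem (poleFn_mem_rrSpace h.nonneg (h.one_le_zero ⟨_, hQ⟩) (h.one_le _ hQ) Q.2)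
      (algebraMap_mem_rrSpace h.nonneg _), fun v hv => ?_⟩
    rw [map_zero, sub_zero]
    exact hasValue_poleFn hP (fun e => hPT (e ▸ hQ)) v hv

theorem finrank_rrSpace₀ [IsAlgClosed Ω] [E.IsElliptic] (h : D.IsReduced T) {P : Pt E K}
    (hP : P ≠ 0) (hPT : P ∉ T) :
    FiniteDimensional K (rrSpace₀ K D (incl E K P)) ∧
      finrank K (rrSpace₀ K D (incl E K P)) = T.card := by
  have e : normFn P '' {Q | (Q : Pt E K) ∈ T} =
      Set.range fun Q : T => normFn P ⟨Q, h.ne_zero Q.2⟩ := by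
    ext f
    constructor
    · rintro ⟨Q, hQ, rfl⟩
      exact ⟨⟨Q, hQ⟩, rfl⟩
    · rintro ⟨Q, rfl⟩
      exact ⟨⟨Q, h.ne_zero Q.2⟩, Q.2, rfl⟩
  have hli : LinearIndependent K fun Q : T => normFn P ⟨Q, h.ne_zero Q.2⟩ :=
    (linearIndependent_normFn P).comp (fun Q : T => ⟨Q, h.ne_zero Q.2⟩) fun Q R hQR =>
      Subtype.ext (Subtype.mk.inj hQR)
  rw [rrSpace₀_eq_span h hP hPT, e]
  refine ⟨FiniteDimensional.span_of_finite K (Set.finite_range _), ?_⟩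
  rw [finrank_span_eq_card hli, Fintype.card_coe]

theorem mem_punctured {S : Finset (Pt E Ω)} {P Q : Pt E Ω} :
    Q ∈ punctured S P ↔ Q ≠ P ∧ Q ∈ S := by
  rw [punctured, Finset.mem_erase]

theorem card_punctured {S : Finset (Pt E Ω)} {P : Pt E Ω} (hP : P ∈ S) :
    (punctured S P).card = S.card - 1 := by
  rw [punctured, Finset.card_erase_of_mem hP]

/-- The zeros of a non-zero `f` in `L_0(D)` at the evaluation points, together with `P`, form a
subset of `S`. It has at most `|T| + 1` elements, and `hsum` excludes equality, so fewer than `|T| =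
dim L_0(D)` of them are evaluation points. -/
theorem isMDS_code₀ [IsAlgClosed Ω] [E.IsElliptic] (h : D.IsReduced T) {S : Finset (Pt E K)}
    (h0 : 0 ∉ S) (hST : ∀ P ∈ S, P ∉ T ∧ -P ∉ T)
    (hsum : ∀ A ⊆ S, A.Nonempty → ∑ Q ∈ A, Q ≠ ∑ Q ∈ T, Q) (hcard : T.card + 1 ≤ S.card)
    {P : Pt E K} (hP : P ∈ S) :
    IsMDS K (code₀ K D (S.image (incl E K)) (incl E K P)) := by
  have hS0 : ∀ Q ∈ S, Q ≠ 0 := fun Q hQ e => h0 (e ▸ hQ)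
  obtain ⟨hfd, hfr⟩ := finrank_rrSpace₀ h (hS0 P hP) (hST P hP).1
  have hρ : ∀ s : punctured (S.image (incl E K)) (incl E K P),
      ∃ R ∈ S, incl E K R = s ∧ R ≠ P := by
    intro s
    obtain ⟨h1, h2⟩ := mem_punctured.mp s.2
    obtain ⟨R, hR, e⟩ := Finset.mem_image.mp h2
    exact ⟨R, hR, e, fun hRP => h1 (by rw [← e, hRP])⟩
  choose ρ hρS hρ hρP using hρ
  have hval : ∀ f ∈ rrSpace K D, ∀ s : punctured (S.image (incl E K)) (incl E K P),
      HasValue f (s : Pt E Ω) (evalAt f (s : Pt E Ω)) := by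
    intro f hf s
    rw [← hρ s]
    obtain ⟨c, hc⟩ := exists_hasValue (hS0 _ (hρS s))
      (h.incl_eq_zero (hS0 _ (hρS s)) (hST _ (hρS s)).1) hf
    rwa [evalAt_eq (hS0 _ (hρS s)) hc]
  have heval : ∀ (f : FunField E K) (s : punctured (S.image (incl E K)) (incl E K P)) (c : K),
      HasValue f (s : Pt E Ω) c → evalAt f (s : Pt E Ω) = c := by
    intro f s c hc
    rw [← hρ s] at hc ⊢
    exact evalAt_eq (hS0 _ (hρS s)) hc
  refine isMDS_of_card_zeros_lt ⟨fun f g => funext fun s => ?_, fun a f => funext fun s => ?_⟩ ?_ ?_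
  · exact heval _ s _ ((hval f f.2.1 s).add (hval g g.2.1 s))
  · exact heval _ s _ ((hval f f.2.1 s).smul a)
  · rw [hfr, Fintype.card_coe, card_punctured (Finset.mem_image_of_mem _ hP),
      Finset.card_image_of_injective _ incl_injective]
    omega
  · intro f hf Z hZ
    rw [hfr]
    obtain ⟨c, a, hca⟩ := h.exists_eq_sum f.2.1
    have hρinj : Function.Injective ρ := fun s t e => Subtype.ext (by rw [← hρ s, ← hρ t, e])
    have hPZ : P ∉ Z.image ρ := by
      intro hmem
      obtain ⟨s, -, e⟩ := Finset.mem_image.mp hmem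
      exact hρP s e
    have hAS : insert P (Z.image ρ) ⊆ S := by
      refine Finset.insert_subset hP fun R hR => ?_
      obtain ⟨s, -, rfl⟩ := Finset.mem_image.mp hR
      exact hρS s
    obtain ⟨h1, h2⟩ := card_zeros_le (W := E.toAffine.baseChange K) (T := T)
      (A := insert P (Z.image ρ)) h.zero_notMem (fun hmem => h0 (hAS hmem))
      (fun R hR => hST R (hAS hR)) c a (f := f) (fun e => hf (Subtype.ext e)) hca (by
        intro R hR v hv
        have hR0 : HasValue (f : FunField E K) (incl E K R) 0 := by
          rcases Finset.mem_insert.mp hR with rfl | hR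
          · exact f.2.2
          · obtain ⟨s, hs, rfl⟩ := Finset.mem_image.mp hR
            rw [hρ s]
            have := hval f f.2.1 s
            have hz : evalAt (f : FunField E K) (s : Pt E Ω) = 0 := hZ s hs
            rwa [hz] at this
        have := (hasValue_incl_iff hv.ne_zero).mp hR0 v hv
        rwa [map_zero, sub_zero] at this)
    rw [Finset.card_insert_of_notMem hPZ, Finset.card_image_of_injective _ hρinj] at h1 h2
    -- The `+ 1` on the left is the zero at `P`; the one on the right is the possible pole at
    -- infinity.
    have h3 : Z.card + 1 ≠ T.card + 1 := fun e =>
      hsum _ hAS (Finset.insert_nonempty _ _) (h2 e)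
    omega

theorem divisorOf_eq {X : Set (Pt E Ω)} (hX : X.Finite) :
    (divisorOf X : Divisor E Ω) = ∑ Q ∈ hX.toFinset, Finsupp.single Q 1 :=
  finsum_mem_eq_finite_toFinset_sum _ hX

theorem divisorOf_apply {X : Set (Pt E Ω)} (hX : X.Finite) (Q : Pt E Ω) :
    (divisorOf X : Divisor E Ω) Q = if Q ∈ X then 1 else 0 := by
  rw [divisorOf_eq hX, Finsupp.finsetSum_apply]
  simp [Finsupp.single_apply]

theorem degree_divisorOf {X : Set (Pt E Ω)} (hX : X.Finite) :
    (divisorOf X : Divisor E Ω).degree = hX.toFinset.card := by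
  rw [divisorOf_eq hX, map_sum]
  simp [Finsupp.degree_single]

theorem isReduced_divisorOf {X : Set (Pt E Ω)} (hX : X.Finite) (hX0 : X.Nonempty → 0 ∈ X)
    (hXK : ∀ Q ∈ X, IsRational E K Q) (hT : ∀ R, R ∈ T ↔ R ≠ 0 ∧ incl E K R ∈ X) :
    (divisorOf X : Divisor E Ω).IsReduced T where
  zero_notMem h := ((hT 0).mp h).1 rfl
  nonneg Q := by
    rw [divisorOf_apply hX]
    split_ifs <;> simp
  le_one Q := by
    rw [divisorOf_apply hX]
    split_ifs <;> simp
  eq_zero Q hQ h := by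
    rw [divisorOf_apply hX, if_neg]
    intro hQX
    obtain ⟨R, rfl⟩ := isRational_iff.mp (hXK Q hQX)
    exact h R ((hT R).mpr ⟨by rintro rfl; exact hQ (map_zero _), hQX⟩) rfl
  one_le R hR := by
    rw [divisorOf_apply hX, if_pos ((hT R).mp hR).2]
  one_le_zero := by
    rintro ⟨R, hR⟩
    rw [divisorOf_apply hX, if_pos (hX0 ⟨_, ((hT R).mp hR).2⟩)]

variable (E) in
-- Adjoin to `L` the finitely many coordinates of the points of `B`, all algebraic over `k`.
theorem exists_forall_isRational [Algebra.IsAlgebraic k Ω] (B : Finset (Pt E Ω))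
    (L : IntermediateField k Ω) [FiniteDimensional k L] :
    ∃ K : IntermediateField k Ω, L ≤ K ∧ FiniteDimensional k K ∧ ∀ Q ∈ B, IsRational E K Q := by
  let co : Pt E Ω → Finset Ω
    | .zero => ∅
    | .some x y _ => {x, y}
  let A : Set Ω := ↑(B.biUnion co)
  have hA : FiniteDimensional k (IntermediateField.adjoin k A) :=
    IntermediateField.finiteDimensional_adjoin fun x _ => Algebra.IsIntegral.isIntegral x
  refine ⟨L ⊔ IntermediateField.adjoin k A, le_sup_left, inferInstance, fun Q hQ => ?_⟩
  have hmem : ∀ x ∈ co Q, x ∈ L ⊔ IntermediateField.adjoin k A := fun x hx =>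
    le_sup_right (a := L) (IntermediateField.subset_adjoin k A
      (Finset.mem_coe.mpr (Finset.mem_biUnion.mpr ⟨Q, hQ, hx⟩)))
  cases Q with
  | zero => exact ⟨0, map_zero _⟩
  | some x y h =>
    have hx := hmem x (by simp [co])
    have hy := hmem y (by simp [co])
    refine ⟨.some ⟨x, hx⟩ ⟨y, hy⟩ ?_, rfl⟩
    exact (E.toAffine.baseChange_nonsingular (f := (L ⊔ IntermediateField.adjoin k A).val)
      (L ⊔ IntermediateField.adjoin k A).val.injective ⟨x, hx⟩ ⟨y, hy⟩).mp h

end Code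

/-! ### Divisors of finite symmetric sets, and the divisors `D_n` -/

section KernelDivisor

open WeierstrassCurve WeierstrassCurve.Affine

open scoped Classical

variable {k Ω : Type*} [Field k] [Field Ω] [Algebra k Ω] {E : WeierstrassCurve k}
  {K : IntermediateField k Ω}

/-- The non-zero points over `K` of a finite set of points. -/
noncomputable def ratPoints (K : IntermediateField k Ω) {X : Set (Pt E Ω)} (hX : X.Finite) :
    Finset (Pt E K) :=
  (hX.toFinset.preimage (incl E K) incl_injective.injOn).erase 0

theorem mem_ratPoints {X : Set (Pt E Ω)} {hX : X.Finite} {R : Pt E K} :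
    R ∈ ratPoints K hX ↔ R ≠ 0 ∧ incl E K R ∈ X := by
  rw [ratPoints, Finset.mem_erase, Finset.mem_preimage, Set.Finite.mem_toFinset]

theorem image_incl_ratPoints {X : Set (Pt E Ω)} (hX : X.Finite)
    (hXK : ∀ Q ∈ X, IsRational E K Q) :
    (ratPoints K hX).image (incl E K) = hX.toFinset.erase 0 := by
  ext Q
  rw [Finset.mem_image, Finset.mem_erase, Set.Finite.mem_toFinset]
  constructor
  · rintro ⟨R, hR, rfl⟩
    obtain ⟨h1, h2⟩ := mem_ratPoints.mp hR
    exact ⟨incl_ne_zero h1, h2⟩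
  · rintro ⟨h1, h2⟩
    obtain ⟨R, rfl⟩ := isRational_iff.mp (hXK Q h2)
    exact ⟨R, mem_ratPoints.mpr ⟨by rintro rfl; exact h1 (map_zero _), h2⟩, rfl⟩

theorem incl_sum_ratPoints {X : Set (Pt E Ω)} (hX : X.Finite)
    (hXK : ∀ Q ∈ X, IsRational E K Q) :
    incl E K (∑ R ∈ ratPoints K hX, R) = ∑ Q ∈ hX.toFinset, Q := by
  rw [map_sum, ← Finset.sum_image (f := fun Q => Q) incl_injective.injOn,
    image_incl_ratPoints hX hXK, Finset.sum_erase (f := fun Q => Q) _ rfl]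

/-- The code of the divisor of a finite symmetric set `X` of points is MDS, if no non-empty subset
of the set `S` of evaluation points has the same sum as `X`. -/
theorem isMDS_code₀_divisorOf [IsAlgClosed Ω] [E.IsElliptic] {X : Set (Pt E Ω)} (hX : X.Finite)
    (hX0 : X.Nonempty → 0 ∈ X) (hXneg : ∀ Q ∈ X, -Q ∈ X) (hXK : ∀ Q ∈ X, IsRational E K Q)
    {S : Finset (Pt E Ω)} (hSK : ∀ Q ∈ S, IsRational E K Q) (hS0 : 0 ∉ S)
    (hSX : ∀ Q ∈ S, Q ∉ X) (hsum : ∀ A ⊆ S, A.Nonempty → ∑ Q ∈ A, Q ≠ ∑ Q ∈ hX.toFinset, Q)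
    (hcard : hX.toFinset.card < S.card) {P : Pt E Ω} (hP : P ∈ S) :
    IsMDS K (code₀ K (divisorOf X) S P) := by
  set S' : Finset (Pt E K) := S.preimage (incl E K) incl_injective.injOn with hS'
  have hmem : ∀ R, R ∈ S' ↔ incl E K R ∈ S := fun R => Finset.mem_preimage
  have hSS : S'.image (incl E K) = S := by
    ext Q
    rw [Finset.mem_image]
    constructor
    · rintro ⟨R, hR, rfl⟩
      exact (hmem R).mp hR
    · intro hQ
      obtain ⟨R, rfl⟩ := isRational_iff.mp (hSK Q hQ)
      exact ⟨R, (hmem R).mpr hQ, rfl⟩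
  obtain ⟨P', rfl⟩ := isRational_iff.mp (hSK P hP)
  rw [← hSS]
  refine isMDS_code₀ (T := ratPoints K hX)
    (isReduced_divisorOf hX hX0 hXK fun R => mem_ratPoints) ?_ ?_ ?_ ?_ ((hmem P').mpr hP)
  · rw [hmem, map_zero]
    exact hS0
  · intro R hR
    refine ⟨fun h => hSX _ ((hmem R).mp hR) (mem_ratPoints.mp h).2, fun h => ?_⟩
    -- By symmetry, avoiding `X` means avoiding `-X` as well, as the count of zeros requires.
    have := hXneg _ (mem_ratPoints.mp h).2
    rw [map_neg, neg_neg] at this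
    exact hSX _ ((hmem R).mp hR) this
  · intro A hA hAne e
    have := congrArg (incl E K) e
    rw [incl_sum_ratPoints hX hXK, map_sum,
      ← Finset.sum_image (f := fun Q => Q) incl_injective.injOn] at this
    refine hsum _ ?_ (hAne.image _) this
    rw [← hSS]
    exact Finset.image_subset_image hA
  · have h1 : (ratPoints K hX).card ≤ hX.toFinset.card := by
      rw [← Finset.card_image_of_injective _ (incl_injective (E := E) (K := K)),
        image_incl_ratPoints hX hXK]
      exact Finset.card_erase_le
    have h2 : S'.card = S.card := by
      rw [← hSS, Finset.card_image_of_injective _ incl_injective]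
    omega

/-- A union of sets that meet at most in `0` gives a decomposition of `L_0`. -/
theorem isDirectSum_rrSpace₀ [IsAlgClosed Ω] [E.IsElliptic] {J : Type*} {X : Set (Pt E Ω)}
    {Y : J → Set (Pt E Ω)} (hX : X.Finite) (hXY : X = ⋃ j, Y j) (hY0 : ∀ j, 0 ∈ Y j)
    (hY : Pairwise fun i j => ∀ Q ∈ Y i, Q ∈ Y j → Q = 0)
    (hXK : ∀ Q ∈ X, IsRational E K Q) {P : Pt E Ω} (hPK : IsRational E K P) (hP : P ≠ 0)
    (hPX : P ∉ X) :
    IsDirectSum (rrSpace₀ K (divisorOf X) P) fun j => rrSpace₀ K (divisorOf (Y j)) P := by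
  have hsub : ∀ j, Y j ⊆ X := fun j => hXY ▸ Set.subset_iUnion Y j
  have hfin : ∀ j, (Y j).Finite := fun j => hX.subset (hsub j)
  obtain ⟨P', rfl⟩ := isRational_iff.mp hPK
  have hP' : P' ≠ 0 := by
    rintro rfl
    exact hP (map_zero _)
  have h1 : rrSpace₀ K (divisorOf X) (incl E K P') = Submodule.span K
      (normFn P' '' ⋃ j, {Q | (Q : Pt E K) ∈ ratPoints K (hfin j)}) := by
    rw [rrSpace₀_eq_span (T := ratPoints K hX)
      (isReduced_divisorOf hX ?_ hXK fun R => mem_ratPoints) hP'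
      fun h => hPX (mem_ratPoints.mp h).2]
    · congr 2
      ext Q
      rw [Set.mem_iUnion]
      change (Q : Pt E K) ∈ ratPoints K hX ↔ ∃ j, (Q : Pt E K) ∈ ratPoints K (hfin j)
      simp only [mem_ratPoints, hXY, Set.mem_iUnion, exists_and_left]
    · rintro ⟨Q, hQ⟩
      rw [hXY, Set.mem_iUnion] at hQ
      obtain ⟨j, -⟩ := hQ
      exact hsub j (hY0 j)
  have h2 : ∀ j, rrSpace₀ K (divisorOf (Y j)) (incl E K P') = Submodule.span K
      (normFn P' '' {Q | (Q : Pt E K) ∈ ratPoints K (hfin j)}) := fun j =>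
    rrSpace₀_eq_span (isReduced_divisorOf (hfin j) (fun _ => hY0 j)
      (fun Q hQ => hXK Q (hsub j hQ)) fun R => mem_ratPoints) hP'
      fun h => hPX (hsub j (mem_ratPoints.mp h).2)
  rw [h1, funext h2]
  -- The basis is indexed by non-zero points, and two of the sets `Y j` share only the point `0`.
  refine isDirectSum_span_image (linearIndependent_normFn P') fun i j hij => ?_
  refine Set.disjoint_left.mpr fun Q hi hj => Q.2 ?_
  refine incl_injective (E := E) (K := K) ?_
  rw [map_zero]
  exact hY hij _ (mem_ratPoints.mp hi).2 (mem_ratPoints.mp hj).2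

theorem disjoint_support_divisorOf {X : Set (Pt E Ω)} (hX : X.Finite) {S : Finset (Pt E Ω)}
    (hSX : ∀ Q ∈ S, Q ∉ X) : Disjoint S (divisorOf X : Divisor E Ω).support := by
  rw [Finset.disjoint_left]
  intro Q hQ h
  rw [Finsupp.mem_support_iff, divisorOf_apply hX, if_neg (hSX Q hQ)] at h
  exact h rfl

variable [Fintype k]

theorem finite_kernelUnion (n : ℕ) : (kernelUnion E Ω n).Finite :=
  n.primeFactors.finite_toSet.biUnion fun _ hr =>
    finite_kernelSet E (Nat.prime_of_mem_primeFactors hr).ne_zero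

theorem mem_kernelUnion {n : ℕ} {Q : Pt E Ω} :
    Q ∈ kernelUnion E Ω n ↔ ∃ r ∈ n.primeFactors, Q ∈ kernelSet E Ω r := by
  simp only [kernelUnion, Set.mem_iUnion, exists_prop]

theorem zero_mem_kernelUnion {n : ℕ} (h : (kernelUnion E Ω n).Nonempty) :
    0 ∈ kernelUnion E Ω n := by
  obtain ⟨Q, hQ⟩ := h
  obtain ⟨r, hr, -⟩ := mem_kernelUnion.mp hQ
  exact mem_kernelUnion.mpr ⟨r, hr, zero_mem_kernelSet E r⟩

theorem neg_mem_kernelUnion {n : ℕ} {Q : Pt E Ω} (hQ : Q ∈ kernelUnion E Ω n) :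
    -Q ∈ kernelUnion E Ω n := by
  obtain ⟨r, hr, h⟩ := mem_kernelUnion.mp hQ
  exact mem_kernelUnion.mpr ⟨r, hr, neg_mem_kernelSet E h⟩

theorem kernelUnion_prime {r : ℕ} (hr : r.Prime) : kernelUnion E Ω r = kernelSet E Ω r := by
  ext Q
  simp [mem_kernelUnion, hr.primeFactors]

theorem kernelUnion_eq_iUnion (n : ℕ) :
    kernelUnion E Ω n = ⋃ r : n.primeFactors, kernelUnion E Ω r := by
  ext Q
  rw [mem_kernelUnion, Set.mem_iUnion]
  constructor
  · rintro ⟨r, hr, hQ⟩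
    exact ⟨⟨r, hr⟩, by rwa [kernelUnion_prime (Nat.prime_of_mem_primeFactors hr)]⟩
  · rintro ⟨⟨r, hr⟩, hQ⟩
    exact ⟨r, hr, by rwa [kernelUnion_prime (Nat.prime_of_mem_primeFactors hr)] at hQ⟩

end KernelDivisor

end EllipticCode

/-! ### The main theorem -/

open EllipticCode in
theorem theorem1p2 {k Ω : Type*} [Field k] [Fintype k] [Field Ω] [Algebra k Ω] [IsAlgClosure k Ω]
    (E : WeierstrassCurve k) [E.IsElliptic] (N : ℕ) (hN : Squarefree N)
    (kN : IntermediateField k Ω) (hkN : Module.finrank k kN = N)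
    (m : ℕ) (hm : (EllipticCode.kernelDivisor E Ω N).degree < (m : ℤ)) :
    ∃ K : IntermediateField k Ω, kN ≤ K ∧ FiniteDimensional k K ∧
      ∃ S : Finset (EllipticCode.Pt E Ω),
        (∀ Q ∈ S, EllipticCode.IsRational E K Q) ∧
        Disjoint S (EllipticCode.kernelDivisor E Ω N).support ∧
        S.card = m ∧
        ∀ P ∈ S,
          EllipticCode.IsMDS K (EllipticCode.code₀ K (EllipticCode.kernelDivisor E Ω N) S P) ∧
          (∀ r ∈ N.primeFactors,
            EllipticCode.IsMDS K (EllipticCode.code₀ K (EllipticCode.kernelDivisor E Ω r) S P)) ∧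
          EllipticCode.IsProperDecomposition
            (EllipticCode.evalOn K (EllipticCode.punctured S P))
            (EllipticCode.rrSpace₀ K (EllipticCode.kernelDivisor E Ω N) P)
            (fun r : N.primeFactors =>
              EllipticCode.rrSpace₀ K (EllipticCode.kernelDivisor E Ω (r : ℕ)) P) := by
  classical
  have : IsAlgClosed Ω := IsAlgClosure.isAlgClosed k
  have : Algebra.IsAlgebraic k Ω := IsAlgClosure.isAlgebraic
  have : FiniteDimensional k kN :=
    FiniteDimensional.of_finrank_pos (hkN ▸ Nat.pos_of_ne_zero hN.ne_zero)
  have hinf : Infinite (Pt E Ω) := infinite_pt E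
  have hfin : ∀ n, (kernelUnion E Ω n).Finite := finite_kernelUnion
  -- A single `S` serves all the codes: its subset sums avoid the sum of `X_N` and the sums of all
  -- `G_r`. The point `0` is excluded separately since `X_N` is empty for `N = 1`.
  obtain ⟨S, hSm, hSB, hSC⟩ := exists_finset_sum_notMem
    (insert 0 (hfin N).toFinset)
    (insert (∑ Q ∈ (hfin N).toFinset, Q)
      (N.primeFactors.image fun r => ∑ Q ∈ (hfin r).toFinset, Q)) m
  -- The field is chosen after `S`, so that the evaluation points and the poles become rational
  -- together.
  obtain ⟨K, hK, hKfin, hKB⟩ := exists_forall_isRational E (S ∪ (hfin N).toFinset) kN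
  have hSK : ∀ Q ∈ S, IsRational E K Q := fun Q hQ => hKB Q (Finset.mem_union_left _ hQ)
  have hXK : ∀ Q ∈ kernelUnion E Ω N, IsRational E K Q := fun Q hQ =>
    hKB Q (Finset.mem_union_right _ ((hfin N).mem_toFinset.mpr hQ))
  have hS0 : 0 ∉ S := fun h => Finset.disjoint_left.mp hSB h (Finset.mem_insert_self _ _)
  have hSX : ∀ Q ∈ S, Q ∉ kernelUnion E Ω N := fun Q h hQ => Finset.disjoint_left.mp hSB h
    (Finset.mem_insert_of_mem ((hfin N).mem_toFinset.mpr hQ))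
  have hsub : ∀ r ∈ N.primeFactors, kernelUnion E Ω r ⊆ kernelUnion E Ω N := by
    intro r hr
    rw [kernelUnion_eq_iUnion N]
    exact Set.subset_iUnion (fun r : N.primeFactors => kernelUnion E Ω r) ⟨r, hr⟩
  have hcard : (hfin N).toFinset.card < S.card := by
    rw [hSm]
    rw [kernelDivisor, degree_divisorOf (hfin N)] at hm
    exact_mod_cast hm
  refine ⟨K, hK, hKfin, S, hSK, disjoint_support_divisorOf (hfin N) hSX, hSm, fun P hP => ?_⟩
  have hmds : IsMDS K (code₀ K (kernelDivisor E Ω N) S P) :=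
    isMDS_code₀_divisorOf (hfin N) zero_mem_kernelUnion (fun _ => neg_mem_kernelUnion) hXK hSK hS0
      hSX (fun A hA hne e => hSC A hA hne (e ▸ Finset.mem_insert_self _ _)) hcard hP
  have hmds_factor : ∀ r ∈ N.primeFactors, IsMDS K (code₀ K (kernelDivisor E Ω r) S P) :=
    fun r hr => isMDS_code₀_divisorOf (hfin r) zero_mem_kernelUnion (fun _ => neg_mem_kernelUnion)
      (fun Q hQ => hXK Q (hsub r hr hQ)) hSK hS0 (fun Q hQ h => hSX Q hQ (hsub r hr h))
      (fun A hA hne e => hSC A hA hne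
        (e ▸ Finset.mem_insert_of_mem (Finset.mem_image_of_mem _ hr)))
      ((Finset.card_le_card (Set.Finite.toFinset_subset_toFinset.mpr (hsub r hr))).trans_lt hcard)
      hP
  refine ⟨hmds, hmds_factor, ?_, hmds, fun r => hmds_factor r r.2⟩
  have hprime : ∀ r : N.primeFactors, (r : ℕ).Prime := fun r => Nat.prime_of_mem_primeFactors r.2
  refine isDirectSum_rrSpace₀ (hfin N) (kernelUnion_eq_iUnion N) (fun r => ?_) (fun r s hrs => ?_)
    hXK (hSK P hP) (fun h => hS0 (h ▸ hP)) (hSX P hP)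
  · rw [kernelUnion_prime (hprime r)]
    exact zero_mem_kernelSet E r
  · intro Q
    rw [kernelUnion_prime (hprime r), kernelUnion_prime (hprime s)]
    exact kernelSet_inter_eq_zero E ((Nat.coprime_primes (hprime r) (hprime s)).mpr
      fun e => hrs (Subtype.ext e))
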